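/- Let $\mathbf{C}$ and $\mathbf{D}$ be varieties of algebras, possibly with infinitary operations, each having a small set of operation symbols. Write $\Omega_{\mathbf C},\Omega_{\mathbf D}$ for the sets of operation symbols and $\mathrm{ari}(\alpha)$ for the arity (a cardinal) of a symbol $\alpha$. Let $\lambda_{\mathbf C}$, $\lambda_{\mathbf D}$ be regular infinite cardinals such that $\lambda_{\mathbf C}$ is greater than all arities of the operations of $\mathbf C$, every defining identity of $\mathbf C$ is an equation between two terms in fewer than $\lambda_{\mathbf C}$ indeterminates, and likewise for $\lambda_{\mathbf D}$ and $\mathbf D$. An $\Omega_{\mathbf D}$-coalgebra $R$ in $\mathbf C$ is an object $|R|$ of $\mathbf C$ with a morphism (co-operation) $\alpha^R:|R|\to\coprod_{\mathrm{ari}(\alpha)}|R|$ for each $\alpha\in\Omega_{\mathbf D}$. The co-operations make each set $\mathbf C(|R|,A)$ an $\Omega_{\mathbf D}$-algebra. $R$ is a $\mathbf D$-coalgebra in $\mathbf C$ if for every identity $s=t$ of $\mathbf D$ in $\kappa$ indeterminates, the $\kappa$-tuple of coprojections satisfies $s=t$ in $\mathbf C(|R|,\coprod_\kappa|R|)$ (equivalently,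 if all the algebras $\mathbf C(|R|,A)$ lie in $\mathbf D$). Morphisms of coalgebras are morphisms of the underlying objects that commute with the co-operations. A $\mathbf D$-pseudocoalgebra $S$ in $\mathbf C$ consists of objects $S_{\mathrm{base}}$ and $S_\alpha$ $(\alpha\in\Omega_{\mathbf D})$ of $\mathbf C$ and arbitrary morphisms $c^S_{\alpha,\iota}:S_{\mathrm{base}}\to S_\alpha$ $(\iota\in\mathrm{ari}(\alpha))$ and $\alpha^S:S_{\mathrm{base}}\to S_\alpha$. Morphisms of pseudocoalgebras are families of morphisms of the base objects and of the objects indexed by $\alpha$ that commute with all the $c_{\alpha,\iota}$ and $\alpha^S$. Every coalgebra $R$ is regarded as a pseudocoalgebra with base $|R|$, objects $\coprod_{\mathrm{ari}(\alpha)}|R|$, the coprojections and the co-operations. A $\mathbf D$-coalgebra over $S$ is a $\mathbf D$-coalgebra $R$ together with a morphism of pseudocoalgebras $R\to S$; morphisms of coalgebras over $S$ are the morphisms of coalgebras that commute with the morphisms to $S$. For a cardinal $\kappa$ and an infinite cardinal $\lambda$ let $\kappa^{\lambda-}$ denote the least cardinal $\mu\ge\kappa$ such that $\mu^\iota=\mu$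 for all cardinals $\iota$ with $0<\iota<\lambda$. Theorem. Let $S$ be a $\mathbf D$-pseudocoalgebra in $\mathbf C$. Then the category of $\mathbf D$-coalgebras in $\mathbf C$ over $S$ has a final object, and the cardinality of the underlying set of this object is at most $$\max\bigl(|S_{\mathrm{base}}|,\ \lambda_{\mathbf D}\bigr)^{\max(|\Omega_{\mathbf C}|,\ |\Omega_{\mathbf D}|,\ 2)^{\lambda_{\mathbf C}-}}.$$ -/

import Mathlib

open CategoryTheory CategoryTheory.Limits Cardinal

universe u v w

namespace UnivAlg

/-- An algebraic type: a small set of operation symbols, each with a (possibly infinite)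
small index set of arguments. The arity of `α` is the cardinal `#(ar α)`. -/
structure Signature where
  /-- the set of operation symbols -/
  Op : Type u
  /-- the index set of the arguments of an operation symbol -/
  ar : Op → Type u

/-- The term algebra on a set `X` of indeterminates, i.e. the free algebra of the given type. -/
inductive Term (Ω : Signature.{u}) (X : Type u) : Type u
  | var : X → Term Ω X
  | op : (α : Ω.Op) → (Ω.ar α → Term Ω X) → Term Ω X

/-- The value `s(x)` of a term at a tuple `x` of elements of a set with operations `f`,
i.e. the image of `s` under the homomorphism that extends `x`. -/
def Term.eval {Ω : Signature.{u}} {X : Type u} {B : Type v}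
    (f : ∀ α : Ω.Op, (Ω.ar α → B) → B) (x : X → B) : Term Ω X → B
  | .var i => x i
  | .op α t => f α (fun i => (t i).eval f x)

/-- The data that determine a variety of (possibly infinitary) algebras: a type, a regular
infinite cardinal `lam` greater than all arities, and a small set of identities, each an equation
between two terms in fewer than `lam` indeterminates. -/
structure Variety extends Signature.{u} where
  /-- a regular infinite cardinal greater than all arities -/
  lam : Cardinal.{u}
  lam_isRegular : lam.IsRegular
  mk_ar_lt : ∀ α : Op, #(ar α) < lam
  /-- the index set of the defining identities -/
  Eqn : Type u
  /-- the indeterminates of an identity -/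
  vars : Eqn → Type u
  mk_vars_lt : ∀ e, #(vars e) < lam
  /-- the left-hand side of an identity -/
  lhs : ∀ e, Term toSignature (vars e)
  /-- the right-hand side of an identity -/
  rhs : ∀ e, Term toSignature (vars e)

/-- An algebra in the variety `C`: a set with operations that satisfy the identities of `C`. -/
structure Alg (C : Variety.{u}) where
  carrier : Type u
  op : ∀ α : C.Op, (C.ar α → carrier) → carrier
  sat : ∀ (e : C.Eqn) (x : C.vars e → carrier), (C.lhs e).eval op x = (C.rhs e).eval op x

/-- Homomorphisms of algebras. -/
@[ext]
structure Alg.Hom {C : Variety.{u}} (A B : Alg C) where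
  toFun : A.carrier → B.carrier
  map_op : ∀ (α : C.Op) (x : C.ar α → A.carrier),
    toFun (A.op α x) = B.op α (fun i => toFun (x i))

instance (C : Variety.{u}) : Category.{u} (Alg C) where
  Hom A B := Alg.Hom A B
  id A := ⟨id, fun _ _ => rfl⟩
  comp f g := ⟨g.toFun ∘ f.toFun, fun α x => by
    simp only [Function.comp_apply, f.map_op, g.map_op]⟩

theorem Alg.hom_ext {C : Variety.{u}} {A B : Alg C} {f g : A ⟶ B}
    (h : ∀ a, Alg.Hom.toFun f a = Alg.Hom.toFun g a) : f = g :=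
  Alg.Hom.ext (funext h)

/-! ### Coproducts of algebras -/

section Coproducts

theorem Term.eval_map {Ω : Signature.{u}} {X : Type u} {B : Type v} {B' : Type w}
    (f : ∀ α : Ω.Op, (Ω.ar α → B) → B) (f' : ∀ α : Ω.Op, (Ω.ar α → B') → B')
    (h : B → B') (hh : ∀ α x, h (f α x) = f' α (fun i => h (x i)))
    (x : X → B) (t : Term Ω X) : h (t.eval f x) = t.eval f' (fun i => h (x i)) := by
  induction t with
  | var _ => rfl
  | op α t ih => simp only [Term.eval, hh, ih]

variable {C : Variety.{u}} {J : Type u} (A : J → Alg C)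

/-- The congruence on the term algebra on the disjoint union of the `A j` that is generated by
the operation tables of the `A j` and by all instances of the identities of `C`. -/
inductive CoprodRel :
    Term C.toSignature (Σ j, (A j).carrier) → Term C.toSignature (Σ j, (A j).carrier) → Prop
  | refl (s) : CoprodRel s s
  | symm {s t} : CoprodRel s t → CoprodRel t s
  | trans {s t r} : CoprodRel s t → CoprodRel t r → CoprodRel s r
  | congr (α : C.Op) (s t : C.ar α → Term C.toSignature (Σ j, (A j).carrier)) :
      (∀ i, CoprodRel (s i) (t i)) → CoprodRel (.op α s) (.op α t)
  | table (j : J) (α : C.Op) (x : C.ar α → (A j).carrier) :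
      CoprodRel (.op α (fun i => .var ⟨j, x i⟩)) (.var ⟨j, (A j).op α x⟩)
  | ident (e : C.Eqn) (x : C.vars e → Term C.toSignature (Σ j, (A j).carrier)) :
      CoprodRel ((C.lhs e).eval .op x) ((C.rhs e).eval .op x)

/-- The congruence above as a setoid. -/
def coprodSetoid : Setoid (Term C.toSignature (Σ j, (A j).carrier)) :=
  ⟨CoprodRel A, ⟨.refl, .symm, .trans⟩⟩

/-- The operations of the coproduct algebra. -/
noncomputable def coprodOp (α : C.Op) (x : C.ar α → Quotient (coprodSetoid A)) :
    Quotient (coprodSetoid A) :=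
  Quotient.mk _ (.op α (fun i => (x i).out))

theorem coprodOp_mk (α : C.Op) (t : C.ar α → Term C.toSignature (Σ j, (A j).carrier)) :
    Quotient.mk (coprodSetoid A) (.op α t) =
      coprodOp A α (fun i => Quotient.mk (coprodSetoid A) (t i)) :=
  Quotient.sound (.congr α _ _ fun _ =>
    .symm (Quotient.exact (s := coprodSetoid A) (Quotient.out_eq _)))

/-- The coproduct of a family of algebras. -/
noncomputable def coprodAlg : Alg C where
  carrier := Quotient (coprodSetoid A)
  op := coprodOp A
  sat e x := by
    have hx : x = fun i => Quotient.mk (coprodSetoid A) (x i).out :=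
      funext fun i => (Quotient.out_eq _).symm
    rw [hx, ← Term.eval_map Term.op (coprodOp A) (Quotient.mk (coprodSetoid A))
      (coprodOp_mk A), ← Term.eval_map Term.op (coprodOp A) (Quotient.mk (coprodSetoid A))
      (coprodOp_mk A)]
    exact Quotient.sound (.ident e _)

/-- The coprojections. -/
noncomputable def coprodInj (j : J) : A j ⟶ coprodAlg A :=
  Alg.Hom.mk (fun a => Quotient.mk (coprodSetoid A) (.var ⟨j, a⟩)) fun α x =>
    (Quotient.sound (CoprodRel.symm (.table j α x))).trans (coprodOp_mk A α _)

theorem coprodRel_eval {B : Alg C} (f : ∀ j, A j ⟶ B)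
    {s t : Term C.toSignature (Σ j, (A j).carrier)} (h : CoprodRel A s t) :
    s.eval B.op (fun a => Alg.Hom.toFun (f a.1) a.2) =
      t.eval B.op (fun a => Alg.Hom.toFun (f a.1) a.2) := by
  induction h with
  | refl => rfl
  | symm _ ih => exact ih.symm
  | trans _ _ ih ih' => exact ih.trans ih'
  | congr α s t _ ih => simp only [Term.eval, ih]
  | table j α x => exact (Alg.Hom.map_op (f j) α x).symm
  | ident e x =>
    rw [Term.eval_map Term.op B.op (Term.eval B.op _) (fun _ _ => rfl),
      Term.eval_map Term.op B.op (Term.eval B.op _) (fun _ _ => rfl)]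
    exact B.sat e _

/-- The homomorphism out of the coproduct that is given by a family of homomorphisms. -/
noncomputable def coprodDesc {B : Alg C} (f : ∀ j, A j ⟶ B) : coprodAlg A ⟶ B :=
  Alg.Hom.mk
    (Quotient.lift (fun s => s.eval B.op (fun a => Alg.Hom.toFun (f a.1) a.2))
      fun _ _ h => coprodRel_eval A f h)
    fun α x => by
      have hx : x = fun i => Quotient.mk (coprodSetoid A) (x i).out :=
        funext fun i => (Quotient.out_eq _).symm
      rw [hx]
      exact congrArg _ (coprodOp_mk A α _).symm

theorem coprod_hom_ext {B : Alg C} {f g : coprodAlg A ⟶ B}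
    (h : ∀ j, coprodInj A j ≫ f = coprodInj A j ≫ g) : f = g := by
  apply Alg.hom_ext
  intro a
  obtain ⟨s, rfl⟩ := Quotient.exists_rep a
  induction s with
  | var a => exact congrFun (congrArg Alg.Hom.toFun (h a.1)) a.2
  | op α t ih =>
    rw [coprodOp_mk]
    exact (Alg.Hom.map_op f α _).trans
      ((congrArg (B.op α) (funext ih)).trans (Alg.Hom.map_op g α _).symm)

instance : HasCoproducts.{u} (Alg C) :=
  hasCoproducts_of_colimit_cofans (fun A => Cofan.mk (coprodAlg A) (coprodInj A))
    (fun A => Cofan.IsColimit.mk _ (fun s => coprodDesc A s.inj)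
      (fun _ _ => rfl)
      (fun _ _ hm => coprod_hom_ext A fun j => hm j))

end Coproducts

/-! ### Coalgebras -/

section Coalgebras

variable (Ω : Signature.{u}) (𝒜 : Type w) [Category.{v} 𝒜]

/-- A coalgebra of type `Ω` in a category: an object with, for each operation symbol `α`,
a co-operation into its copower indexed by the arity of `α`. -/
structure OmegaCoalg [HasCoproducts.{u} 𝒜] where
  obj : 𝒜
  coop : ∀ α : Ω.Op, obj ⟶ ∐ fun _ : Ω.ar α => obj

variable {Ω 𝒜}

/-- Morphisms of coalgebras: they make commuting squares with the co-operations. -/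
@[ext]
structure OmegaCoalg.Hom [HasCoproducts.{u} 𝒜] (R R' : OmegaCoalg Ω 𝒜) where
  hom : R.obj ⟶ R'.obj
  comm : ∀ α : Ω.Op, R.coop α ≫ Limits.Sigma.map (fun _ : Ω.ar α => hom) = hom ≫ R'.coop α

noncomputable instance [HasCoproducts.{u} 𝒜] : Category.{v} (OmegaCoalg Ω 𝒜) where
  Hom R R' := OmegaCoalg.Hom R R'
  id R := ⟨𝟙 _, fun α => by simp⟩
  comp f g := ⟨f.hom ≫ g.hom, fun α => by
    rw [Category.assoc, ← g.comm α, ← Category.assoc f.hom, ← f.comm α, Category.assoc]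
    congr 1
    ext i
    simp⟩
  id_comp f := OmegaCoalg.Hom.ext (Category.id_comp f.hom)
  comp_id f := OmegaCoalg.Hom.ext (Category.comp_id f.hom)
  assoc f g h := OmegaCoalg.Hom.ext (Category.assoc f.hom g.hom h.hom)

/-- The operation induced by the co-operation of `α` on the set of morphisms `R.obj ⟶ B`. -/
noncomputable def OmegaCoalg.homOp [HasCoproducts.{u} 𝒜] (R : OmegaCoalg Ω 𝒜) (B : 𝒜)
    (α : Ω.Op) (x : Ω.ar α → (R.obj ⟶ B)) : R.obj ⟶ B :=
  R.coop α ≫ Limits.Sigma.desc x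

/-- `R` cosatisfies the identity `s = t` in the indeterminates `X`: the tuple of coprojections
`R.obj ⟶ ∐_X R.obj` satisfies it in the algebra of all morphisms from `R.obj` to `∐_X R.obj`. -/
def OmegaCoalg.Cosatisfies [HasCoproducts.{u} 𝒜] (R : OmegaCoalg Ω 𝒜) {X : Type u}
    (s t : Term Ω X) : Prop :=
  s.eval (R.homOp (∐ fun _ : X => R.obj)) (fun i => Limits.Sigma.ι (fun _ : X => R.obj) i) =
    t.eval (R.homOp (∐ fun _ : X => R.obj)) (fun i => Limits.Sigma.ι (fun _ : X => R.obj) i)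

/-- Equivalently, all algebras of morphisms out of `R` satisfy the identity. -/
theorem OmegaCoalg.cosatisfies_iff [HasCoproducts.{u} 𝒜] (R : OmegaCoalg Ω 𝒜) {X : Type u}
    (s t : Term Ω X) : R.Cosatisfies s t ↔
      ∀ (B : 𝒜) (x : X → (R.obj ⟶ B)), s.eval (R.homOp B) x = t.eval (R.homOp B) x := by
  refine ⟨fun h B x => ?_, fun h => h _ _⟩
  have key : ∀ s : Term Ω X, s.eval (R.homOp B) x =
      s.eval (R.homOp (∐ fun _ : X => R.obj))
        (fun i => Limits.Sigma.ι (fun _ : X => R.obj) i) ≫ Limits.Sigma.desc x := by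
    intro s
    rw [Term.eval_map (R.homOp (∐ fun _ : X => R.obj)) (R.homOp B)
      (fun g => g ≫ Limits.Sigma.desc x)]
    · simp
    · intro α y
      simp only [OmegaCoalg.homOp, Category.assoc]
      congr 1
      ext i
      simp
  rw [key, key, h]

/-- The category of `D`-coalgebras in `𝒜`: the full subcategory of the coalgebras of the type
of `D` that cosatisfy the identities of `D`. -/
abbrev Coalg (D : Variety.{u}) (𝒜 : Type w) [Category.{v} 𝒜] [HasCoproducts.{u} 𝒜] :=
  ObjectProperty.FullSubcategory (C := OmegaCoalg D.toSignature 𝒜)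
    (fun R => ∀ e : D.Eqn, R.Cosatisfies (D.lhs e) (D.rhs e))

/-! ### Pseudocoalgebras -/

variable (Ω 𝒜)

/-- Pseudocoalgebras: a base object, pseudocopower objects, pseudocoprojections and
pseudo-co-operations. -/
structure Pseudocoalg where
  base : 𝒜
  obj : Ω.Op → 𝒜
  coproj : ∀ α : Ω.Op, Ω.ar α → (base ⟶ obj α)
  coop : ∀ α : Ω.Op, base ⟶ obj α

variable {Ω 𝒜}

/-- Morphisms of pseudocoalgebras. -/
@[ext]
structure Pseudocoalg.Hom (S S' : Pseudocoalg Ω 𝒜) where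
  base : S.base ⟶ S'.base
  obj : ∀ α : Ω.Op, S.obj α ⟶ S'.obj α
  comm_coproj : ∀ (α : Ω.Op) (i : Ω.ar α), S.coproj α i ≫ obj α = base ≫ S'.coproj α i
  comm_coop : ∀ α : Ω.Op, S.coop α ≫ obj α = base ≫ S'.coop α

instance : Category.{max u v} (Pseudocoalg Ω 𝒜) where
  Hom S S' := Pseudocoalg.Hom S S'
  id S := ⟨𝟙 _, fun _ => 𝟙 _, fun _ _ => by simp, fun _ => by simp⟩
  comp f g := ⟨f.base ≫ g.base, fun α => f.obj α ≫ g.obj α,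
    fun α i => by
      rw [← Category.assoc, f.comm_coproj, Category.assoc, g.comm_coproj, Category.assoc],
    fun α => by
      rw [← Category.assoc, f.comm_coop, Category.assoc, g.comm_coop, Category.assoc]⟩
  id_comp f := Pseudocoalg.Hom.ext (Category.id_comp _) (funext fun _ => Category.id_comp _)
  comp_id f := Pseudocoalg.Hom.ext (Category.comp_id _) (funext fun _ => Category.comp_id _)
  assoc f g h := Pseudocoalg.Hom.ext (Category.assoc _ _ _) (funext fun _ => Category.assoc _ _ _)

/-- The functor that regards a coalgebra as a pseudocoalgebra. -/
noncomputable def psi (Ω : Signature.{u}) (𝒜 : Type w) [Category.{v} 𝒜] [HasCoproducts.{u} 𝒜] :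
    OmegaCoalg Ω 𝒜 ⥤ Pseudocoalg Ω 𝒜 where
  obj R :=
    { base := R.obj
      obj := fun α => ∐ fun _ : Ω.ar α => R.obj
      coproj := fun α i => Limits.Sigma.ι (fun _ : Ω.ar α => R.obj) i
      coop := R.coop }
  map f :=
    { base := OmegaCoalg.Hom.hom f
      obj := fun α => Limits.Sigma.map (fun _ : Ω.ar α => OmegaCoalg.Hom.hom f)
      comm_coproj := fun α i => by simp
      comm_coop := OmegaCoalg.Hom.comm f }
  map_id R := Pseudocoalg.Hom.ext rfl (funext fun α => by
    change Limits.Sigma.map (fun _ => 𝟙 R.obj) = 𝟙 _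
    simp)
  map_comp {R R' R''} f g := Pseudocoalg.Hom.ext rfl (funext fun α => by
    change Limits.Sigma.map (fun _ => OmegaCoalg.Hom.hom f ≫ OmegaCoalg.Hom.hom g) =
      Limits.Sigma.map (fun _ => OmegaCoalg.Hom.hom f) ≫
        Limits.Sigma.map (fun _ => OmegaCoalg.Hom.hom g)
    ext i
    simp)

/-- The category of `D`-coalgebras in `𝒜` over a pseudocoalgebra `S`: the comma category of
`D`-coalgebras with a morphism of pseudocoalgebras to `S`. -/
abbrev CoalgOver (D : Variety.{u}) {𝒜 : Type w} [Category.{v} 𝒜] [HasCoproducts.{u} 𝒜]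
    (S : Pseudocoalg D.toSignature 𝒜) :=
  CostructuredArrow (ObjectProperty.ι _ ⋙ psi D.toSignature 𝒜 : Coalg D 𝒜 ⥤ _) S

end Coalgebras

/-! ### Cardinals -/

/-- The cardinal `κ ^ (l-)`: the least cardinal `m ≥ κ` with `m ^ i = m` for all nonzero
cardinals `i < l`. -/
noncomputable def expLess (κ l : Cardinal.{u}) : Cardinal.{u} :=
  sInf {m | κ ≤ m ∧ ∀ i : Cardinal.{u}, i ≠ 0 → i < l → m ^ i = m}

theorem isLeast_expLess (κ : Cardinal.{u}) {l : Cardinal.{u}} (hl : ℵ₀ ≤ l) :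
    IsLeast {m | κ ≤ m ∧ ∀ i : Cardinal.{u}, i ≠ 0 → i < l → m ^ i = m} (expLess κ l) := by
  refine ⟨csInf_mem ⟨κ ^ l, ?_, fun i h0 hi => ?_⟩, fun m hm => csInf_le' hm⟩
  · exact self_le_power κ (one_le_aleph0.trans hl)
  · rw [← power_mul, mul_eq_left hl hi.le h0]

end UnivAlg

open UnivAlg

namespace UnivAlg

/-! ### Cardinals that absorb small powers -/

section Cardinals

variable {l m : Cardinal.{u}}

/-! Put m = max(|Ω_C|, |Ω_D|, 2)^{λ_C-} and k = max(|S_base|, λ_D). Call a coalgebra over S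
subterminal if it receives at most one morphism from each coalgebra over S. The plan is to bound the
subterminal objects by k^m and to build the final object as one of them.

Each X maps to a subterminal object (`CoalgOver.exists_subterminal`): divide X by the congruence
generated by the kernels of all its quotients over S. Coequalizing two morphisms into the result M
would give a further quotient of X, whose kernel is already killed in M, so the two morphisms agree.

Each element of a coalgebra over S lies in the image of one with at most m elements
(`CoalgOver.exists_small_hom`). Closing off under the operations of C, under the constituents of
terms for the values of the co-operations, and under witnesses for relations in copowers gives a
subalgebra whose inclusion stays injective on all copowers. The co-operations therefore restrict to
it and the identities of D are inherited.

Coalgebras over S with at most m elements are described by at most k^m codes (`Code.mk_le`). Each of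
them has at most one morphism to a subterminal V, so an element of V is determined by a code and one
of its at most m elements. Hence |V| ≤ k^m (`CoalgOver.mk_le_of_subterminal`).

So the subterminal objects form a small family up to isomorphism. A coproduct W of representatives
of all coalgebras of size at most k^m maps to a subterminal T, and any R maps to T by way of a
subterminal V, its representative, and W. Thus T is final, and the bound applies to it. -/

theorem le_of_power_eq (h2 : 2 ≤ m)
    (hm : ∀ i : Cardinal.{u}, i ≠ 0 → i < l → m ^ i = m) : l ≤ m := by
  by_contra! h
  have h0 : m ≠ 0 := by
    rintro rfl
    simp at h2
  -- If m < l, then m itself is an admissible exponent, which contradicts Cantor's theorem.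
  have h1 := hm m h0 h
  have h3 : m < m ^ m := cantor' m (lt_of_lt_of_le (by norm_num) h2)
  exact absurd h1 h3.ne'

theorem power_le_self_of_power_eq (hm1 : 1 ≤ m)
    (hm : ∀ i : Cardinal.{u}, i ≠ 0 → i < l → m ^ i = m) {i : Cardinal.{u}} (hi : i < l) :
    m ^ i ≤ m := by
  by_cases h0 : i = 0
  · simpa [h0] using hm1
  · exact (hm i h0 hi).le

/-- Since m * i = m, the power `k ^ m` absorbs small exponents; this allows terms over a set of size
up to `k ^ m` to be counted by `Term.mk_le`. -/
theorem power_eq_of_le_exponent {k : Cardinal.{u}} (hlm : l ≤ m) (hm : ℵ₀ ≤ m)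
    (i : Cardinal.{u}) (h0 : i ≠ 0) (hi : i < l) : (k ^ m) ^ i = k ^ m := by
  rw [← power_mul, mul_eq_left hm (hi.le.trans hlm) h0]

theorem sum_le_of_le {ι : Type u} (f : ι → Cardinal.{u}) (hm : ℵ₀ ≤ m) (hι : #ι ≤ m)
    (hf : ∀ i, f i ≤ m) : Cardinal.sum f ≤ m :=
  calc Cardinal.sum f ≤ Cardinal.sum fun _ : ι => m := sum_le_sum _ _ hf
    _ = #ι * m := sum_const' _ _
    _ ≤ m * m := mul_le_mul_left hι m
    _ = m := mul_eq_self hm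

theorem mk_iUnion_le_of_le {ι α : Type u} (f : ι → Set α) (hm : ℵ₀ ≤ m) (hι : #ι ≤ m)
    (hf : ∀ i, #(f i) ≤ m) : #(⋃ i, f i : Set α) ≤ m :=
  mk_iUnion_le_sum_mk.trans (sum_le_of_le _ hm hι hf)

theorem mk_wType_le {ι : Type u} {β : ι → Type u} (hm : ℵ₀ ≤ m) (hι : #ι ≤ m)
    (hβ : ∀ a, #(β a) < l) (hpow : ∀ i : Cardinal.{u}, i ≠ 0 → i < l → m ^ i = m) :
    #(WType β) ≤ m :=
  WType.cardinalMk_le_of_le <| sum_le_of_le _ hm hι fun a =>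
    power_le_self_of_power_eq (one_le_aleph0.trans hm) hpow (hβ a)

/-- The arities of the term algebra as a `W`-type. -/
def Term.Branch (Ω : Signature.{u}) (X : Type u) : X ⊕ Ω.Op → Type u
  | .inl _ => PEmpty
  | .inr α => Ω.ar α

/-- Terms as elements of a `W`-type. -/
def Term.toW {Ω : Signature.{u}} {X : Type u} : Term Ω X → WType (Term.Branch Ω X)
  | .var x => ⟨.inl x, fun i => nomatch (i : PEmpty)⟩
  | .op α t => ⟨.inr α, fun i => (t i).toW⟩

theorem Term.toW_injective {Ω : Signature.{u}} {X : Type u} :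
    Function.Injective (Term.toW (Ω := Ω) (X := X)) := by
  intro s t h
  induction s generalizing t with
  | var x =>
    cases t with
    | var y =>
      have := (WType.mk.inj h).1
      rw [Sum.inl.inj this]
    | op α t => exact absurd (WType.mk.inj h).1 (by simp)
  | op α s ih =>
    cases t with
    | var y => exact absurd (WType.mk.inj h).1 (by simp)
    | op β t =>
      obtain ⟨h1, h2⟩ := WType.mk.inj h
      obtain rfl := Sum.inr.inj h1
      congr 1
      funext i
      exact ih i (congrFun (eq_of_heq h2) i)

theorem Term.mk_le {Ω : Signature.{u}} {X : Type u} (hm : ℵ₀ ≤ m) (hX : #X ≤ m) (hΩ : #Ω.Op ≤ m)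
    (hl : 0 < l) (har : ∀ α, #(Ω.ar α) < l)
    (hpow : ∀ i : Cardinal.{u}, i ≠ 0 → i < l → m ^ i = m) : #(Term Ω X) ≤ m := by
  refine (mk_le_of_injective Term.toW_injective).trans (mk_wType_le (l := l) hm ?_ ?_ hpow)
  · rw [mk_sum, lift_id, lift_id]
    exact add_le_of_le hm hX hΩ
  · rintro (x | α)
    · exact (mk_pempty : #PEmpty.{u + 1} = 0).trans_lt hl
    · exact har α

/-- The closure is the set of values of well-founded trees in which each node enumerates F of the
set of values of its children. The hypothesis on powers bounds the number of trees by m, and no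
transfinite union of stages is needed. -/
theorem exists_closed_superset {R : Type u} (hl : ℵ₀ ≤ l) (hm : ℵ₀ ≤ m) (hlm : l ≤ m)
    (hpow : ∀ i : Cardinal.{u}, i ≠ 0 → i < l → m ^ i = m)
    (F : Set R → Set R) (hF : ∀ Z : Set R, #Z < l → #(F Z) ≤ m) (r : R) :
    ∃ Y : Set R, r ∈ Y ∧ #Y ≤ m ∧ ∀ Z ⊆ Y, #Z < l → F Z ⊆ Y := by
  classical
  -- One enumeration of F Z by m, with r added so that it is never empty and so that the trees
  -- produce r. Sets Z that are too large get the constant enumeration r.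
  have hr : ∀ Z : Set R, ∃ e : m.out → R, r ∈ Set.range e ∧ (#Z < l → F Z ⊆ Set.range e) := by
    intro Z
    by_cases hZ : #Z < l
    · have : #(insert r (F Z) : Set R) ≤ #m.out := by
        rw [mk_out]
        exact (mk_insert_le).trans (add_le_of_le hm (hF Z hZ) (one_le_aleph0.trans hm))
      obtain ⟨⟨f, hf⟩⟩ := this
      have : Nonempty (insert r (F Z) : Set R) := ⟨⟨r, by simp⟩⟩
      refine ⟨fun a => (Function.invFun f a).1, ⟨f ⟨r, by simp⟩, ?_⟩, fun _ x hx =>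
        ⟨f ⟨x, by simp [hx]⟩, ?_⟩⟩
      · simp [Function.leftInverse_invFun hf _]
      · simp [Function.leftInverse_invFun hf _]
    · have : Nonempty m.out := by
        rw [← mk_ne_zero_iff, mk_out]
        exact (aleph0_pos.trans_le hm).ne'
      exact ⟨fun _ => r, ⟨Classical.arbitrary _, rfl⟩, fun h => absurd h hZ⟩
  choose e he hFe using hr
  -- In a label (b, a), the initial segment below b indexes the children and a selects an entry of
  -- the enumeration.
  let β : l.ord.ToType × m.out → Type u := fun p => Set.Iio p.1
  let ev : WType β → R := fun w => w.elim R fun q => e (Set.range q.2) q.1.2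
  have hβ : ∀ a, #(β a) < l := fun a =>
    (mk_Iio_lt a.1 (by simp)).trans_eq (mk_ord_toType l)
  refine ⟨Set.range ev, ?_, ?_, ?_⟩
  · have : Nonempty l.ord.ToType := by
      rw [← mk_ne_zero_iff, mk_ord_toType]
      exact (aleph0_pos.trans_le hl).ne'
    have hne : l.ord.ToType := Classical.arbitrary _
    -- The least b gives trees without children, and one of these has the value r.
    obtain ⟨b, -, hb⟩ := (wellFounded_lt (α := l.ord.ToType)).has_min Set.univ
      ⟨hne, trivial⟩
    have : IsEmpty (Set.Iio b) := ⟨fun x => hb x.1 trivial x.2⟩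
    obtain ⟨a, ha⟩ := he (Set.range fun i : Set.Iio b => (isEmptyElim i : R))
    refine ⟨⟨(b, a), fun i => (this.elim i)⟩, ?_⟩
    rw [← ha]
    change e (Set.range _) a = _
    congr 2
    funext i
    exact this.elim i
  · refine mk_range_le.trans (mk_wType_le hm ?_ hβ hpow)
    rw [mk_prod, lift_id, lift_id, mk_out, mk_ord_toType]
    exact mul_le_of_le hm hlm le_rfl
  · intro Z hZ hZl x hx
    obtain ⟨a, rfl⟩ := hFe Z hZl hx
    -- Every cardinal below l is the size of an initial segment, so Z is the set of values of the
    -- children of a suitable node.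
    have : ∃ b : l.ord.ToType, #(Set.Iio b) = #Z := by
      have hlt : (#Z).ord < Ordinal.type (α := l.ord.ToType) (· < ·) := by
        rw [Ordinal.type_toType]
        exact ord_lt_ord.2 hZl
      refine ⟨Ordinal.enum (α := l.ord.ToType) (· < ·) ⟨_, hlt⟩, ?_⟩
      have := Ordinal.typein_enum (α := l.ord.ToType) (· < ·) hlt
      have h2 := congrArg Ordinal.card this
      rw [card_ord] at h2
      exact h2
    obtain ⟨b, hb⟩ := this
    obtain ⟨φ⟩ := Cardinal.eq.1 hb
    choose g hg using fun z : Z => hZ z.2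
    refine ⟨⟨(b, a), fun i => g (φ i)⟩, ?_⟩
    change e (Set.range fun i => ev (g (φ i))) a = _
    simp only [hg]
    congr 1
    rw [← Function.comp_def, EquivLike.range_comp, Subtype.range_coe]

end Cardinals

end UnivAlg

namespace UnivAlg

/-! ### Renaming of indeterminates -/

section Terms

variable {Ω : Signature.{u}} {X Y Z : Type u}

/-- Renaming of indeterminates in a term. -/
def Term.map (f : X → Y) (t : Term Ω X) : Term Ω Y :=
  t.eval .op fun x => .var (f x)

@[simp]
theorem Term.map_var (f : X → Y) (x : X) : (Term.var x : Term Ω X).map f = .var (f x) := rfl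

@[simp]
theorem Term.map_op (f : X → Y) (α : Ω.Op) (t : Ω.ar α → Term Ω X) :
    (Term.op α t).map f = .op α fun i => (t i).map f := rfl

theorem Term.map_eval {V : Type u} (f : X → Y) (y : V → Term Ω X) (t : Term Ω V) :
    (t.eval .op y).map f = t.eval .op fun v => (y v).map f :=
  Term.eval_map Term.op Term.op (Term.map f) (fun _ _ => rfl) y t

theorem Term.eval_of_map {B : Type v} (g : ∀ α : Ω.Op, (Ω.ar α → B) → B) (f : X → Y)
    (y : Y → B) (t : Term Ω X) : (t.map f).eval g y = t.eval g fun x => y (f x) :=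
  Term.eval_map Term.op g (Term.eval g y) (fun _ _ => rfl) _ t

theorem Term.map_map (f : X → Y) (g : Y → Z) (t : Term Ω X) :
    (t.map f).map g = t.map (g ∘ f) :=
  Term.eval_of_map _ _ _ t

theorem Term.map_id (t : Term Ω X) : t.map id = t := by
  induction t with
  | var x => rfl
  | op α t ih => simp [ih]

theorem Term.map_injective {f : X → Y} (hf : Function.Injective f) :
    Function.Injective (Term.map (Ω := Ω) f) := by
  intro s t h
  induction s generalizing t with
  | var x =>
    cases t with
    | var y => rw [hf (Term.var.inj h)]
    | op α t => cases h
  | op α s ih =>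
    cases t with
    | var y => cases h
    | op β t =>
      obtain ⟨rfl, h2⟩ := Term.op.inj h
      congr 1
      funext i
      exact ih i (congrFun (eq_of_heq h2) i)

theorem Term.exists_map_of_range {f : X → Y} {g : Z → Y} (h : Set.range f ⊆ Set.range g)
    (t : Term Ω X) : ∃ t' : Term Ω Z, t'.map g = t.map f := by
  choose k hk using fun x => h ⟨x, rfl⟩
  exact ⟨t.map k, by rw [Term.map_map]; congr 1; exact funext hk⟩

/-- A term contains few indeterminates. -/
theorem Term.exists_small_support {l : Cardinal.{u}} (hl : l.IsRegular) (har : ∀ α, #(Ω.ar α) < l)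
    (t : Term Ω X) :
    ∃ W : Set X, #W < l ∧ ∃ t' : Term Ω W, t'.map Subtype.val = t := by
  induction t with
  | var x =>
    refine ⟨{x}, ?_, .var ⟨x, rfl⟩, rfl⟩
    rw [mk_singleton]
    exact one_lt_aleph0.trans_le hl.aleph0_le
  | op α t ih =>
    choose W hW t' ht' using ih
    refine ⟨⋃ i, W i, (card_iUnion_lt_iff_forall_of_isRegular hl (har α)).2 hW, ?_⟩
    have : ∀ i, ∃ s : Term Ω (⋃ i, W i : Set X), s.map Subtype.val = t i := by
      intro i
      rw [← ht' i]
      apply Term.exists_map_of_range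
      simp only [Subtype.range_coe]
      exact Set.subset_iUnion W i
    choose s hs using this
    exact ⟨.op α s, by simp [hs]⟩

end Terms

/-! ### Elements of copowers as values of terms -/

section Copowers

variable {C : Variety.{u}}

@[simp]
theorem Alg.comp_toFun {A B B' : Alg C} (f : A ⟶ B) (g : B ⟶ B') (a : A.carrier) :
    Alg.Hom.toFun (f ≫ g) a = Alg.Hom.toFun g (Alg.Hom.toFun f a) := rfl

theorem Alg.Hom.map_eval {A B : Alg C} (f : A ⟶ B) {X : Type u} (x : X → A.carrier)
    (t : Term C.toSignature X) :
    Alg.Hom.toFun f (t.eval A.op x) = t.eval B.op fun i => Alg.Hom.toFun f (x i) :=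
  Term.eval_map A.op B.op f.toFun (Alg.Hom.map_op f) x t

/-- The element of the copower that is denoted by a term. -/
noncomputable def termVal (J : Type u) (A : Alg C)
    (t : Term C.toSignature (Σ _ : J, A.carrier)) : (∐ fun _ : J => A).carrier :=
  t.eval (∐ fun _ : J => A).op fun p => Alg.Hom.toFun (Sigma.ι (fun _ : J => A) p.1) p.2

theorem quotMk_eq_eval {J : Type u} (A : J → Alg C)
    (t : Term C.toSignature (Σ j, (A j).carrier)) :
    (Quotient.mk (coprodSetoid A) t : (coprodAlg A).carrier) =
      t.eval (coprodAlg A).op fun p => Alg.Hom.toFun (coprodInj A p.1) p.2 := by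
  induction t with
  | var x => rfl
  | op α t ih =>
    rw [coprodOp_mk]
    exact congrArg (coprodOp A α) (funext ih)

/-- Comparison with the syntactic coproduct `coprodAlg` turns equality in the abstractly chosen
copower into derivability, on which induction is possible. -/
theorem termVal_eq_iff {J : Type u} {A : Alg C} {s t : Term C.toSignature (Σ _ : J, A.carrier)} :
    termVal J A s = termVal J A t ↔ CoprodRel (fun _ : J => A) s t := by
  constructor
  · intro h
    have h' := congrArg (Alg.Hom.toFun
      (Limits.Sigma.desc (f := fun _ : J => A) (coprodInj fun _ : J => A))) h
    simp only [termVal, Alg.Hom.map_eval, ← Alg.comp_toFun, colimit.ι_desc, Cofan.mk_ι_app] at h'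
    rw [← quotMk_eq_eval (fun _ : J => A), ← quotMk_eq_eval (fun _ : J => A)] at h'
    exact Quotient.exact (s := coprodSetoid fun _ : J => A) h'
  · exact coprodRel_eval _ _

/-- The map from the copower to `coprodAlg` and back is the identity, and elements of `coprodAlg`
are classes of terms. -/
theorem termVal_surjective {J : Type u} {A : Alg C} : Function.Surjective (termVal J A) := by
  intro z
  have hid : Limits.Sigma.desc (f := fun _ : J => A) (coprodInj fun _ : J => A) ≫
      coprodDesc (fun _ : J => A) (Sigma.ι fun _ : J => A) = 𝟙 _ := by
    apply Limits.Sigma.hom_ext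
    intro j
    rw [← Category.assoc]
    simp only [colimit.ι_desc, Cofan.mk_ι_app]
    rw [Category.comp_id]
    rfl
  obtain ⟨t, ht⟩ := Quotient.exists_rep
    (Alg.Hom.toFun (Limits.Sigma.desc (f := fun _ : J => A) (coprodInj fun _ : J => A)) z)
  refine ⟨t, ?_⟩
  have h := congrArg (Alg.Hom.toFun (coprodDesc (fun _ : J => A) (Sigma.ι fun _ : J => A))) ht
  rw [← Alg.comp_toFun, hid] at h
  exact h

/-- Change of the index set and of the algebra in the indeterminates of a copower. -/
def sigmaMap {J K : Type u} {A B : Type u} (g : J → K) (f : A → B) (p : Σ _ : J, A) : Σ _ : K, B :=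
  ⟨g p.1, f p.2⟩

theorem sigmaMap_injective {J K A B : Type u} {g : J → K} {f : A → B}
    (hg : Function.Injective g) (hf : Function.Injective f) :
    Function.Injective (sigmaMap g f) := by
  rintro ⟨j, a⟩ ⟨j', a'⟩ h
  obtain ⟨h1, h2⟩ := Sigma.mk.inj h
  obtain rfl : j = j' := hg h1
  obtain rfl : a = a' := hf (eq_of_heq h2)
  rfl

theorem termVal_map {J K : Type u} {A B : Alg C} (g : J → K) (f : A ⟶ B)
    (t : Term C.toSignature (Σ _ : J, A.carrier)) :
    termVal K B (t.map (sigmaMap g f.toFun)) =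
      Alg.Hom.toFun (Limits.Sigma.desc fun j => f ≫ Sigma.ι (fun _ : K => B) (g j))
        (termVal J A t) := by
  simp only [termVal, Term.eval_of_map, Alg.Hom.map_eval, ← Alg.comp_toFun, colimit.ι_desc,
    Cofan.mk_ι_app]
  rfl

theorem termVal_map_id {J : Type u} {A B : Alg C} (f : A ⟶ B)
    (t : Term C.toSignature (Σ _ : J, A.carrier)) :
    termVal J B (t.map (sigmaMap id f.toFun)) =
      Alg.Hom.toFun (Limits.Sigma.map fun _ : J => f) (termVal J A t) := by
  rw [termVal_map]
  congr 2

theorem CoprodRel.map {J K : Type u} {A B : Alg C} (g : J → K) (f : A ⟶ B)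
    {s t : Term C.toSignature (Σ _ : J, A.carrier)} (h : CoprodRel (fun _ : J => A) s t) :
    CoprodRel (fun _ : K => B) (s.map (sigmaMap g f.toFun)) (t.map (sigmaMap g f.toFun)) := by
  rw [← termVal_eq_iff, termVal_map, termVal_map, termVal_eq_iff.2 h]

/-- A term in the indeterminates of a copower involves few copies and few elements. -/
theorem Term.exists_small_support_sigma {J A : Type u}
    (t : Term C.toSignature (Σ _ : J, A)) :
    ∃ (I : Set J) (W : Set A), #I < C.lam ∧ #W < C.lam ∧
      ∃ t' : Term C.toSignature (Σ _ : I, W), t'.map (sigmaMap Subtype.val Subtype.val) = t := by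
  obtain ⟨V, hV, t', rfl⟩ := t.exists_small_support C.lam_isRegular C.mk_ar_lt
  refine ⟨(fun p => p.1) '' V, (fun p => p.2) '' V, mk_image_le.trans_lt hV,
    mk_image_le.trans_lt hV, t'.map fun p => ⟨⟨p.1.1, p.1, p.2, rfl⟩, ⟨p.1.2, p.1, p.2, rfl⟩⟩, ?_⟩
  rw [Term.map_map]
  rfl

theorem Term.exists_lift_of_subset {J A B : Type u} (t : Term C.toSignature (Σ _ : J, A))
    {W : Set A} (hW : ∃ t' : Term C.toSignature (Σ _ : J, W), t'.map (sigmaMap id Subtype.val) = t)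
    {f : B → A} (hf : W ⊆ Set.range f) :
    ∃ t' : Term C.toSignature (Σ _ : J, B), t'.map (sigmaMap id f) = t := by
  obtain ⟨t', rfl⟩ := hW
  apply Term.exists_map_of_range
  rintro _ ⟨⟨j, w⟩, rfl⟩
  obtain ⟨b, hb⟩ := hf w.2
  exact ⟨⟨j, b⟩, by simp [sigmaMap, hb]⟩

theorem Term.exists_small_support_snd {J A : Type u} (t : Term C.toSignature (Σ _ : J, A)) :
    ∃ W : Set A, #W < C.lam ∧
      ∃ t' : Term C.toSignature (Σ _ : J, W), t'.map (sigmaMap id Subtype.val) = t := by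
  obtain ⟨I, W, -, hW, t', rfl⟩ := t.exists_small_support_sigma
  refine ⟨W, hW, t'.map (sigmaMap Subtype.val id), ?_⟩
  rw [Term.map_map]
  rfl

theorem mk_union_lt {A : Type u} {S T : Set A} (hS : #S < C.lam) (hT : #T < C.lam) :
    #(S ∪ T : Set A) < C.lam :=
  (mk_union_le S T).trans_lt (add_lt_of_lt C.lam_isRegular.aleph0_le hS hT)

/-- A relation in a copower of an algebra is witnessed by few elements of the algebra. -/
theorem CoprodRel.exists_small_witness {J : Type u} {A : Alg C}
    {s t : Term C.toSignature (Σ _ : J, A.carrier)} (h : CoprodRel (fun _ : J => A) s t) :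
    ∃ W : Set A.carrier, #W < C.lam ∧ ∀ (B : Alg C) (f : B ⟶ A), Function.Injective f.toFun →
      W ⊆ Set.range f.toFun → ∀ s' t' : Term C.toSignature (Σ _ : J, B.carrier),
        s'.map (sigmaMap id f.toFun) = s → t'.map (sigmaMap id f.toFun) = t →
          CoprodRel (fun _ : J => B) s' t' := by
  have inj : ∀ {B : Alg C} {f : B ⟶ A}, Function.Injective f.toFun →
      Function.Injective (Term.map (Ω := C.toSignature) (sigmaMap (id : J → J) f.toFun)) :=
    fun hf => Term.map_injective (sigmaMap_injective Function.injective_id hf)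
  have h0 : #(∅ : Set A.carrier) < C.lam := by
    rw [mk_eq_zero]
    exact C.lam_isRegular.pos
  induction h with
  | refl s =>
    refine ⟨∅, h0, fun B f hf _ s' t' hs ht => ?_⟩
    rw [inj hf (hs.trans ht.symm)]
    exact .refl _
  | symm _ ih =>
    obtain ⟨W, hW, h⟩ := ih
    exact ⟨W, hW, fun B f hf hWf s' t' hs ht => (h B f hf hWf t' s' ht hs).symm⟩
  | @trans s t r _ _ ih ih' =>
    obtain ⟨W, hW, h⟩ := ih
    obtain ⟨W', hW', h'⟩ := ih'
    -- The intermediate term of a derivation need not come from B, so the elements occurring in it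
    -- are added to the witnesses.
    obtain ⟨V, hV, hVt⟩ := t.exists_small_support_snd
    refine ⟨W ∪ W' ∪ V, mk_union_lt (mk_union_lt hW hW') hV,
      fun B f hf hWf s' r' hs hr => ?_⟩
    obtain ⟨t', ht'⟩ := t.exists_lift_of_subset hVt (Set.subset_union_right.trans hWf)
    exact (h B f hf (fun x hx => hWf (.inl (.inl hx))) s' t' hs ht').trans
      (h' B f hf (fun x hx => hWf (.inl (.inr hx))) t' r' ht' hr)
  | congr α s t _ ih =>
    choose W hW h using ih
    refine ⟨⋃ i, W i, (card_iUnion_lt_iff_forall_of_isRegular C.lam_isRegular (C.mk_ar_lt α)).2 hW,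
      fun B f hf hWf s' t' hs ht => ?_⟩
    cases s' with
    | var => cases hs
    | op β s' =>
      obtain ⟨rfl, hs⟩ := Term.op.inj hs
      cases t' with
      | var => cases ht
      | op γ t' =>
        obtain ⟨rfl, ht⟩ := Term.op.inj ht
        exact .congr _ _ _ fun i => h i B f hf ((Set.subset_iUnion W i).trans hWf) _ _
          (congrFun (eq_of_heq hs) i) (congrFun (eq_of_heq ht) i)
  | table j α x =>
    refine ⟨∅, h0, fun B f hf _ s' t' hs ht => ?_⟩
    cases s' with
    | var => cases hs
    | op β s' =>
      obtain ⟨rfl, hs⟩ := Term.op.inj hs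
      cases t' with
      | op => cases ht
      | var q =>
        have hs' : ∀ i, ∃ b : B.carrier, s' i = .var ⟨j, b⟩ ∧ f.toFun b = x i := by
          intro i
          have hi := congrFun (eq_of_heq hs) i
          cases hsi : s' i with
          | op => rw [hsi] at hi; cases hi
          | var p =>
            rw [hsi] at hi
            obtain ⟨h1, h2⟩ := Sigma.mk.inj (Term.var.inj hi)
            obtain ⟨j', b⟩ := p
            obtain rfl : j' = j := h1
            exact ⟨b, rfl, eq_of_heq h2⟩
        choose b hb hbx using hs'
        obtain rfl : s' = fun i => .var ⟨j, b i⟩ := funext hb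
        obtain ⟨j', c⟩ := q
        obtain ⟨h1, h2⟩ := Sigma.mk.inj (Term.var.inj ht)
        obtain rfl : j' = j := h1
        -- No witnesses are needed here: B is closed under the operations, and injectivity of f
        -- identifies the table entry.
        have hc : c = B.op _ b := hf <| by
          refine (eq_of_heq h2).trans ?_
          rw [f.map_op]
          congr 1
          exact (funext hbx).symm
        rw [hc]
        exact .table (A := fun _ : J => B) _ _ _
  | ident e x =>
    choose V hV hVx using fun v => (x v).exists_small_support_snd
    refine ⟨⋃ v, V v,
      (card_iUnion_lt_iff_forall_of_isRegular C.lam_isRegular (C.mk_vars_lt e)).2 hV,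
      fun B f hf hWf s' t' hs ht => ?_⟩
    choose y hy using fun v =>
      (x v).exists_lift_of_subset (hVx v) ((Set.subset_iUnion V v).trans hWf)
    have hl : ∀ r : Term C.toSignature (C.vars e),
        (r.eval .op y).map (sigmaMap id f.toFun) = r.eval .op x := by
      intro r
      rw [Term.map_eval]
      congr 1
      exact funext hy
    rw [inj hf (hs.trans (hl (C.lhs e)).symm), inj hf (ht.trans (hl (C.rhs e)).symm)]
    exact .ident (A := fun _ : J => B) e y

end Copowers

end UnivAlg

namespace UnivAlg

/-! ### Pure subalgebras and small subcoalgebras -/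

section Subalgebras

variable {C : Variety.{u}}

/-- The subalgebra on a subset that is closed under the operations. -/
def Alg.sub (A : Alg C) (Y : Set A.carrier)
    (hY : ∀ (α : C.Op) (x : C.ar α → A.carrier), (∀ i, x i ∈ Y) → A.op α x ∈ Y) : Alg C where
  carrier := Y
  op α x := ⟨A.op α fun i => x i, hY α _ fun i => (x i).2⟩
  sat e x := by
    apply Subtype.ext
    have h : ∀ t : Term C.toSignature (C.vars e),
        (t.eval (fun α x => ⟨A.op α fun i => (x i).1, hY α _ fun i => (x i).2⟩) x : Y).1 =
          t.eval A.op fun i => (x i).1 :=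
      Term.eval_map _ A.op Subtype.val (fun _ _ => rfl) x
    rw [h, h, A.sat]

/-- The inclusion of a subalgebra. -/
def Alg.subIncl (A : Alg C) (Y : Set A.carrier)
    (hY : ∀ (α : C.Op) (x : C.ar α → A.carrier), (∀ i, x i ∈ Y) → A.op α x ∈ Y) :
    A.sub Y hY ⟶ A :=
  Alg.Hom.mk Subtype.val fun _ _ => rfl

/-- A homomorphism is pure if it induces injective maps of copowers. -/
def IsPure {B A : Alg C} (f : B ⟶ A) : Prop :=
  ∀ J : Type u, Function.Injective (Alg.Hom.toFun (Limits.Sigma.map fun _ : J => f))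

theorem exists_retraction_on {J K : Type u} [Nonempty J] [Nonempty K] (I : Set J) (hI : #I ≤ #K) :
    ∃ (g : J → K) (h : K → J), ∀ j ∈ I, h (g j) = j := by
  classical
  obtain ⟨⟨e, he⟩⟩ := hI
  let g : J → K := fun j => if hj : j ∈ I then e ⟨j, hj⟩ else Classical.arbitrary K
  have hg : Set.InjOn g I := by
    intro i hi j hj hij
    simp only [g, hi, hj, dif_pos] at hij
    exact congrArg Subtype.val (he hij)
  exact ⟨g, Function.invFunOn g I, fun j hj => hg.leftInvOn_invFunOn hj⟩

/-- Purity can be tested on `lam` copies. -/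
theorem isPure_of_copower_lam {B A : Alg C} (f : B ⟶ A)
    (h : ∀ s t : Term C.toSignature (Σ _ : C.lam.out, B.carrier),
      CoprodRel (fun _ : C.lam.out => A) (s.map (sigmaMap id f.toFun))
        (t.map (sigmaMap id f.toFun)) → CoprodRel (fun _ : C.lam.out => B) s t) :
    IsPure f := by
  intro J
  cases isEmpty_or_nonempty J with
  | inl hJ =>
    -- The empty copower of B is initial, so the map has a left inverse.
    have hid : Limits.Sigma.map (fun _ : J => f) ≫
        Limits.Sigma.desc (fun j => (hJ.elim j : A ⟶ ∐ fun _ : J => B)) = 𝟙 _ := by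
      apply Limits.Sigma.hom_ext
      intro j
      exact hJ.elim j
    intro a b hab
    have := congrArg (Alg.Hom.toFun
      (Limits.Sigma.desc (fun j => (hJ.elim j : A ⟶ ∐ fun _ : J => B)))) hab
    rw [← Alg.comp_toFun, ← Alg.comp_toFun, hid] at this
    exact this
  | inr hJ =>
    intro a b hab
    obtain ⟨s, rfl⟩ := termVal_surjective a
    obtain ⟨t, rfl⟩ := termVal_surjective b
    rw [← termVal_map_id, ← termVal_map_id, termVal_eq_iff] at hab
    rw [termVal_eq_iff]
    obtain ⟨I, V, hI, -, s', hs⟩ := s.exists_small_support_sigma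
    obtain ⟨I', V', hI', -, t', ht⟩ := t.exists_small_support_sigma
    have : Nonempty C.lam.out := by
      rw [← mk_ne_zero_iff, mk_out]
      exact C.lam_isRegular.ne_zero
    -- Two terms involve fewer than λ_C copies. These are moved into λ_C copies by g, compared
    -- there, and moved back by r.
    obtain ⟨g, r, hr⟩ := exists_retraction_on (K := C.lam.out) (I ∪ I')
      ((mk_union_lt hI hI').le.trans_eq (mk_out _).symm)
    have hback : ∀ {I₀ : Set J} {W : Set B.carrier} (_ : I₀ ⊆ I ∪ I')
        (s' : Term C.toSignature (Σ _ : I₀, W)),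
        ((s'.map (sigmaMap Subtype.val Subtype.val)).map (sigmaMap g id)).map
          (sigmaMap r (Alg.Hom.toFun (𝟙 B))) = s'.map (sigmaMap Subtype.val Subtype.val) := by
      intro I₀ W hI₀ s'
      simp only [Term.map_map]
      congr 1
      funext p
      exact Sigma.ext (hr _ (hI₀ p.1.2)) HEq.rfl
    have key := h (s.map (sigmaMap g id)) (t.map (sigmaMap g id)) (by
      have := hab.map g (𝟙 A)
      simp only [Term.map_map] at this ⊢
      exact this)
    have key' := key.map r (𝟙 B)
    rw [← hs, ← ht, hback Set.subset_union_left, hback Set.subset_union_right] at key'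
    rwa [hs, ht] at key'

end Subalgebras

/-! ### Inheritance of identities along morphisms of coalgebras -/

section Subcoalgebras

variable {Ω : Signature.{u}} {𝒜 : Type w} [Category.{v} 𝒜] [HasCoproducts.{u} 𝒜]

theorem OmegaCoalg.comp_eval {R : OmegaCoalg Ω 𝒜} {W B : 𝒜} (g : W ⟶ R.obj)
    (op : ∀ α : Ω.Op, (Ω.ar α → (W ⟶ B)) → (W ⟶ B))
    (hop : ∀ α (x : Ω.ar α → (R.obj ⟶ B)), g ≫ R.homOp B α x = op α fun i => g ≫ x i)
    {X : Type u} (x : X → (R.obj ⟶ B)) (t : Term Ω X) :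
    g ≫ t.eval (R.homOp B) x = t.eval op fun i => g ≫ x i :=
  Term.eval_map (R.homOp B) op (fun k => g ≫ k) hop x t

theorem OmegaCoalg.Hom.comp_eval {R R' : OmegaCoalg Ω 𝒜} (f : OmegaCoalg.Hom R R') (B : 𝒜)
    {X : Type u} (x : X → (R'.obj ⟶ B)) (t : Term Ω X) :
    f.hom ≫ t.eval (R'.homOp B) x = t.eval (R.homOp B) fun i => f.hom ≫ x i := by
  refine OmegaCoalg.comp_eval f.hom (R.homOp B) (fun α y => ?_) x t
  simp only [OmegaCoalg.homOp]
  rw [← Category.assoc, ← f.comm, Category.assoc]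
  congr 1
  ext i
  simp

theorem OmegaCoalg.eval_comp (R : OmegaCoalg Ω 𝒜) {B B' : 𝒜} (g : B ⟶ B')
    {X : Type u} (x : X → (R.obj ⟶ B)) (t : Term Ω X) :
    t.eval (R.homOp B) x ≫ g = t.eval (R.homOp B') fun i => x i ≫ g := by
  refine Term.eval_map (R.homOp B) (R.homOp B') (fun k => k ≫ g) (fun α y => ?_) x t
  simp only [OmegaCoalg.homOp, Category.assoc]
  congr 1
  ext i
  simp

/-- Identities are inherited along a jointly epimorphic family of coalgebra morphisms. -/
theorem OmegaCoalg.Cosatisfies.of_jointly_epi {ι : Type*} {R : ι → OmegaCoalg Ω 𝒜}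
    {R' : OmegaCoalg Ω 𝒜} (f : ∀ k, OmegaCoalg.Hom (R k) R')
    (hf : ∀ (B : 𝒜) (g h : R'.obj ⟶ B), (∀ k, (f k).hom ≫ g = (f k).hom ≫ h) → g = h)
    {X : Type u} {s t : Term Ω X} (h : ∀ k, (R k).Cosatisfies s t) : R'.Cosatisfies s t := by
  rw [OmegaCoalg.cosatisfies_iff]
  intro B x
  apply hf
  intro k
  rw [(f k).comp_eval, (f k).comp_eval]
  exact ((R k).cosatisfies_iff s t).1 (h k) B _

/-- Identities are inherited along a coalgebra morphism that induces a monomorphism of the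
relevant copowers. -/
theorem OmegaCoalg.Cosatisfies.of_mono {R R' : OmegaCoalg Ω 𝒜} (f : OmegaCoalg.Hom R R')
    {X : Type u} {s t : Term Ω X} (hf : Mono (Limits.Sigma.map fun _ : X => f.hom))
    (h : R'.Cosatisfies s t) : R.Cosatisfies s t := by
  unfold OmegaCoalg.Cosatisfies
  rw [← cancel_mono (Limits.Sigma.map fun _ : X => f.hom), R.eval_comp, R.eval_comp]
  have hι : ∀ i, Limits.Sigma.ι (fun _ : X => R.obj) i ≫ Limits.Sigma.map (fun _ : X => f.hom) =
      f.hom ≫ Limits.Sigma.ι (fun _ : X => R'.obj) i := fun i => by simp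
  simp only [hι]
  have h' := congrArg (fun k => f.hom ≫ k) h
  simp only [f.comp_eval] at h'
  exact h'

end Subcoalgebras

/-! ### Small pure subcoalgebras -/

section SmallSubcoalgebras

variable {C : Variety.{u}}

theorem Alg.mono_of_injective {A B : Alg C} (f : A ⟶ B) (hf : Function.Injective f.toFun) :
    Mono f :=
  ⟨fun _ _ hgh => Alg.hom_ext fun a => hf (congrFun (congrArg Alg.Hom.toFun hgh) a)⟩

theorem Alg.exists_lift_of_injective {A B B' : Alg C} (f : A ⟶ B) (hf : Function.Injective f.toFun)
    (g : B' ⟶ B) (hg : Set.range g.toFun ⊆ Set.range f.toFun) : ∃ k : B' ⟶ A, k ≫ f = g := by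
  choose k hk using fun b => hg ⟨b, rfl⟩
  refine ⟨Alg.Hom.mk k fun α x => hf ?_, Alg.hom_ext hk⟩
  rw [hk, f.map_op, g.map_op]
  simp only [hk]

/-- Every element of a coalgebra lies in a small coalgebra that maps to it. -/
theorem OmegaCoalg.exists_small_sub {Ω : Signature.{u}} {m : Cardinal.{u}} (hlm : C.lam ≤ m)
    (hC : #C.Op ≤ m) (hΩ : #Ω.Op ≤ m)
    (hpow : ∀ i : Cardinal.{u}, i ≠ 0 → i < C.lam → m ^ i = m)
    (R : OmegaCoalg Ω (Alg C)) (r : R.obj.carrier) :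
    ∃ (G : OmegaCoalg Ω (Alg C)) (f : OmegaCoalg.Hom G R), IsPure f.hom ∧
      #G.obj.carrier ≤ m ∧ r ∈ Set.range f.hom.toFun := by
  have hm : ℵ₀ ≤ m := C.lam_isRegular.aleph0_le.trans hlm
  have hW₁ : ∀ (α : Ω.Op) (z : R.obj.carrier), ∃ W : Set R.obj.carrier, #W < C.lam ∧
      ∃ t : Term C.toSignature (Σ _ : Ω.ar α, W),
        termVal (Ω.ar α) R.obj (t.map (sigmaMap id Subtype.val)) = (R.coop α).toFun z := by
    intro α z
    obtain ⟨t, ht⟩ := termVal_surjective ((R.coop α).toFun z)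
    obtain ⟨W, hW, t', rfl⟩ := t.exists_small_support_snd
    exact ⟨W, hW, t', ht⟩
  choose W₁ hW₁ t₁ ht₁ using hW₁
  have hW₂ : ∀ s t : Term C.toSignature (Σ _ : C.lam.out, R.obj.carrier),
      ∃ W : Set R.obj.carrier, #W < C.lam ∧ (CoprodRel (fun _ : C.lam.out => R.obj) s t →
        ∀ (B : Alg C) (f : B ⟶ R.obj), Function.Injective f.toFun →
          W ⊆ Set.range f.toFun → ∀ s' t' : Term C.toSignature (Σ _ : C.lam.out, B.carrier),
            s'.map (sigmaMap id f.toFun) = s → t'.map (sigmaMap id f.toFun) = t →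
              CoprodRel (fun _ : C.lam.out => B) s' t') := by
    intro s t
    by_cases h : CoprodRel (fun _ : C.lam.out => R.obj) s t
    · obtain ⟨W, hW, hW'⟩ := h.exists_small_witness
      exact ⟨W, hW, fun _ => hW'⟩
    · exact ⟨∅, by rw [mk_eq_zero]; exact C.lam_isRegular.pos, fun h' => absurd h' h⟩
  choose W₂ hW₂ hrel using hW₂
  let inc (Z : Set R.obj.carrier) : Term C.toSignature (Σ _ : C.lam.out, Z) →
      Term C.toSignature (Σ _ : C.lam.out, R.obj.carrier) := Term.map (sigmaMap id Subtype.val)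
  -- The three parts ensure closure under the operations, lifting of the co-operations, and purity.
  -- Each depends on fewer than λ_C elements at a time.
  let F : Set R.obj.carrier → Set R.obj.carrier := fun Z =>
    (Set.range fun p : Σ α : C.Op, C.ar α → Z => R.obj.op p.1 fun i => p.2 i) ∪
    (⋃ p : Ω.Op × Z, W₁ p.1 p.2) ∪
    ⋃ p : Term C.toSignature (Σ _ : C.lam.out, Z) × Term C.toSignature (Σ _ : C.lam.out, Z),
      W₂ (inc Z p.1) (inc Z p.2)
  have hF : ∀ Z : Set R.obj.carrier, #Z < C.lam → #(F Z) ≤ m := by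
    intro Z hZ
    have hZm : #Z ≤ m := hZ.le.trans hlm
    have hTm : #(Term C.toSignature (Σ _ : C.lam.out, Z)) ≤ m := by
      refine Term.mk_le hm ?_ hC C.lam_isRegular.pos C.mk_ar_lt hpow
      rw [mk_sigma]
      exact sum_le_of_le _ hm ((mk_out _).trans_le hlm) fun _ => hZm
    refine (mk_union_le _ _).trans (add_le_of_le hm ((mk_union_le _ _).trans
      (add_le_of_le hm ?_ ?_)) ?_)
    · refine mk_range_le.trans ?_
      rw [mk_sigma]
      refine sum_le_of_le _ hm hC fun α => ?_
      rw [← power_def]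
      exact (power_le_power_right hZm).trans
        (power_le_self_of_power_eq (one_le_aleph0.trans hm) hpow (C.mk_ar_lt α))
    · refine mk_iUnion_le_of_le _ hm ?_ fun p => (hW₁ p.1 p.2).le.trans hlm
      rw [mk_prod, lift_id, lift_id]
      exact mul_le_of_le hm hΩ hZm
    · refine mk_iUnion_le_of_le _ hm ?_ fun p => (hW₂ _ _).le.trans hlm
      rw [mk_prod, lift_id]
      exact mul_le_of_le hm hTm hTm
  obtain ⟨Y, hrY, hYm, hY⟩ :=
    exists_closed_superset C.lam_isRegular.aleph0_le hm hlm hpow F hF r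
  have hYop : ∀ (α : C.Op) (x : C.ar α → R.obj.carrier), (∀ i, x i ∈ Y) → R.obj.op α x ∈ Y := by
    intro α x hx
    exact hY (Set.range x) (Set.range_subset_iff.2 hx) (mk_range_le.trans_lt (C.mk_ar_lt α))
      (.inl (.inl ⟨⟨α, fun i => ⟨x i, i, rfl⟩⟩, rfl⟩))
  let B := R.obj.sub Y hYop
  let f : B ⟶ R.obj := R.obj.subIncl Y hYop
  have hf : Function.Injective f.toFun := Subtype.val_injective
  have hfr : Set.range f.toFun = Y := Subtype.range_coe
  have hpure : IsPure f := by
    apply isPure_of_copower_lam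
    intro s t hst
    obtain ⟨Vs, hVs, s', hs⟩ := s.exists_small_support_snd
    obtain ⟨Vt, hVt, t', ht⟩ := t.exists_small_support_snd
    -- The few elements that occur in s or t. Closure at this Z supplies the witnesses for the
    -- relation between them.
    let Z : Set R.obj.carrier := f.toFun '' (Vs ∪ Vt)
    have hlift : ∀ {V : Set B.carrier} (_ : V ⊆ Vs ∪ Vt)
        (s' : Term C.toSignature (Σ _ : C.lam.out, V)),
        ∃ s'' : Term C.toSignature (Σ _ : C.lam.out, Z),
          inc Z s'' = (s'.map (sigmaMap id Subtype.val)).map (sigmaMap id f.toFun) := by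
      intro V hV s'
      refine ⟨s'.map (sigmaMap id fun v : V =>
        (⟨f.toFun v.1, v.1, hV v.2, rfl⟩ : Z)), ?_⟩
      simp only [inc, Term.map_map]
      rfl
    obtain ⟨s'', hs''⟩ := hlift Set.subset_union_left s'
    obtain ⟨t'', ht''⟩ := hlift Set.subset_union_right t'
    rw [hs] at hs''
    rw [ht] at ht''
    refine hrel (inc Z s'') (inc Z t'') (by rwa [hs'', ht'']) B f hf ?_ s t hs''.symm ht''.symm
    rw [hfr]
    refine Set.Subset.trans ?_ (hY Z ?_ (mk_image_le.trans_lt (mk_union_lt hVs hVt)))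
    · exact fun x hx => .inr (Set.mem_iUnion.2 ⟨(s'', t''), hx⟩)
    · rintro _ ⟨y, -, rfl⟩
      exact y.2
  have hcoop : ∀ α : Ω.Op, ∃ k : B ⟶ ∐ fun _ : Ω.ar α => B,
      k ≫ Limits.Sigma.map (fun _ => f) = f ≫ R.coop α := by
    intro α
    -- By purity the copower of B embeds in that of R, so it is enough to express the values of the
    -- co-operation by terms over Y.
    apply Alg.exists_lift_of_injective _ (hpure _)
    rintro _ ⟨y, rfl⟩
    have hW : W₁ α (f.toFun y) ⊆ Set.range f.toFun := by
      rw [hfr]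
      refine Set.Subset.trans ?_ (hY {f.toFun y} (Set.singleton_subset_iff.2 y.2) ?_)
      · exact fun x hx => .inl (.inr (Set.mem_iUnion.2 ⟨(α, ⟨f.toFun y, rfl⟩), hx⟩))
      · rw [mk_singleton]
        exact one_lt_aleph0.trans_le C.lam_isRegular.aleph0_le
    obtain ⟨t', ht'⟩ := Term.exists_lift_of_subset _ ⟨t₁ α (f.toFun y), rfl⟩ hW
    refine ⟨termVal _ B t', ?_⟩
    rw [← termVal_map_id, ht', ht₁, Alg.comp_toFun]
  choose k hk using hcoop
  exact ⟨⟨B, k⟩, ⟨f, hk⟩, hpure, hYm, ⟨r, hrY⟩, rfl⟩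

end SmallSubcoalgebras

end UnivAlg

namespace UnivAlg

/-! ### Quotient algebras -/

section Quotients

variable {C : Variety.{u}}

/-- The congruence generated by a relation, described by the homomorphisms that kill it. -/
def Alg.quotSetoid (A : Alg C) (P : A.carrier → A.carrier → Prop) : Setoid A.carrier where
  r a b := ∀ (B : Alg C) (f : A ⟶ B), (∀ x y, P x y → f.toFun x = f.toFun y) →
    f.toFun a = f.toFun b
  iseqv := ⟨fun _ _ _ _ => rfl, fun h B f hf => (h B f hf).symm,
    fun h h' B f hf => (h B f hf).trans (h' B f hf)⟩

/-- The operations of the quotient algebra. -/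
noncomputable def Alg.quotOp (A : Alg C) (P : A.carrier → A.carrier → Prop) (α : C.Op)
    (x : C.ar α → Quotient (A.quotSetoid P)) : Quotient (A.quotSetoid P) :=
  Quotient.mk _ (A.op α fun i => (x i).out)

theorem Alg.quotOp_mk (A : Alg C) (P : A.carrier → A.carrier → Prop) (α : C.Op)
    (x : C.ar α → A.carrier) :
    Quotient.mk (A.quotSetoid P) (A.op α x) =
      A.quotOp P α fun i => Quotient.mk (A.quotSetoid P) (x i) := by
  refine Quotient.sound fun B f hf => ?_
  rw [f.map_op, f.map_op]
  congr 1
  funext i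
  exact (Quotient.exact (s := A.quotSetoid P) (Quotient.out_eq _) B f hf).symm

/-- The quotient of an algebra by the congruence generated by a relation. -/
noncomputable def Alg.quot (A : Alg C) (P : A.carrier → A.carrier → Prop) : Alg C where
  carrier := Quotient (A.quotSetoid P)
  op := A.quotOp P
  sat e x := by
    have hx : x = fun i => Quotient.mk (A.quotSetoid P) (x i).out :=
      funext fun i => (Quotient.out_eq _).symm
    rw [hx, ← Term.eval_map A.op (A.quotOp P) (Quotient.mk (A.quotSetoid P)) (A.quotOp_mk P),
      ← Term.eval_map A.op (A.quotOp P) (Quotient.mk (A.quotSetoid P)) (A.quotOp_mk P), A.sat]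

/-- The quotient map. -/
noncomputable def Alg.quotMk (A : Alg C) (P : A.carrier → A.carrier → Prop) : A ⟶ A.quot P :=
  Alg.Hom.mk (Quotient.mk (A.quotSetoid P)) (A.quotOp_mk P)

theorem Alg.quotMk_surjective (A : Alg C) (P : A.carrier → A.carrier → Prop) :
    Function.Surjective (A.quotMk P).toFun :=
  Quotient.exists_rep

theorem Alg.quotMk_eq {A : Alg C} {P : A.carrier → A.carrier → Prop} {x y : A.carrier}
    (h : P x y) : (A.quotMk P).toFun x = (A.quotMk P).toFun y :=
  Quotient.sound fun _ _ hf => hf x y h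

theorem Alg.exists_factor_of_surjective {A Q B : Alg C} (q : A ⟶ Q)
    (hq : Function.Surjective q.toFun) (f : A ⟶ B)
    (h : ∀ x y, q.toFun x = q.toFun y → f.toFun x = f.toFun y) : ∃ g : Q ⟶ B, q ≫ g = f := by
  choose k hk using hq
  have hkf : ∀ a, f.toFun (k (q.toFun a)) = f.toFun a := fun a => h _ _ (hk _)
  refine ⟨Alg.Hom.mk (fun b => f.toFun (k b)) fun α x => ?_, Alg.hom_ext hkf⟩
  rw [← f.map_op]
  apply h
  rw [hk, q.map_op]
  simp only [hk]

theorem Alg.exists_quotDesc {A B : Alg C} (P : A.carrier → A.carrier → Prop) (f : A ⟶ B)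
    (hf : ∀ x y, P x y → f.toFun x = f.toFun y) : ∃ g : A.quot P ⟶ B, A.quotMk P ≫ g = f :=
  Alg.exists_factor_of_surjective _ (A.quotMk_surjective P) f fun _ _ h =>
    Quotient.exact (s := A.quotSetoid P) h B f hf

theorem Alg.cancel_surjective {A Q B : Alg C} {q : A ⟶ Q} (hq : Function.Surjective q.toFun)
    {f g : Q ⟶ B} (h : q ≫ f = q ≫ g) : f = g := by
  apply Alg.hom_ext
  intro a
  obtain ⟨a, rfl⟩ := hq a
  exact congrFun (congrArg Alg.Hom.toFun h) a

end Quotients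

/-! ### Coalgebras over a pseudocoalgebra -/

section Over

variable {D : Variety.{u}} {𝒜 : Type w} [Category.{v} 𝒜] [HasCoproducts.{u} 𝒜]
  {S : Pseudocoalg D.toSignature 𝒜}

namespace CoalgOver

/-- The underlying coalgebra. -/
noncomputable abbrev coalg (X : CoalgOver D S) : OmegaCoalg D.toSignature 𝒜 := X.left.obj

/-- The morphism to the base object. -/
noncomputable def toBase (X : CoalgOver D S) : X.coalg.obj ⟶ S.base := Pseudocoalg.Hom.base X.hom

/-- Compatibility with the coprojections forces every component from the base component, so a
morphism to S amounts to one morphism to `S.base` with the condition `coop_desc`. -/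
theorem hom_obj_eq_desc (X : CoalgOver D S) (α : D.Op) :
    (Pseudocoalg.Hom.obj X.hom α : (∐ fun _ : D.ar α => X.coalg.obj) ⟶ S.obj α) =
      Limits.Sigma.desc fun i => X.toBase ≫ S.coproj α i := by
  refine Limits.Sigma.hom_ext _ _ fun i =>
    Eq.trans (Pseudocoalg.Hom.comm_coproj X.hom α i) (Eq.symm ?_)
  exact colimit.ι_desc _ _

theorem coop_desc (X : CoalgOver D S) (α : D.Op) :
    X.coalg.coop α ≫ Limits.Sigma.desc (fun i => X.toBase ≫ S.coproj α i) =
      X.toBase ≫ S.coop α := by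
  rw [← hom_obj_eq_desc]
  exact Pseudocoalg.Hom.comm_coop X.hom α

/-- A coalgebra over a pseudocoalgebra is determined by the morphism of the base objects. -/
noncomputable def ofBase (R : OmegaCoalg D.toSignature 𝒜)
    (hR : ∀ e : D.Eqn, R.Cosatisfies (D.lhs e) (D.rhs e)) (b : R.obj ⟶ S.base)
    (hb : ∀ α : D.Op, R.coop α ≫ Limits.Sigma.desc (fun i => b ≫ S.coproj α i) = b ≫ S.coop α) :
    CoalgOver D S :=
  CostructuredArrow.mk (Y := (⟨R, hR⟩ : Coalg D 𝒜))
    (Pseudocoalg.Hom.mk b (fun α => Limits.Sigma.desc fun i => b ≫ S.coproj α i)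
      (fun _ _ => colimit.ι_desc _ _) hb :
        (ObjectProperty.ι _ ⋙ psi D.toSignature 𝒜 : Coalg D 𝒜 ⥤ _).obj ⟨R, hR⟩ ⟶ S)

variable {X Y Z : CoalgOver D S}

/-- The underlying morphism of coalgebras. -/
noncomputable def coalgHom (f : X ⟶ Y) : OmegaCoalg.Hom X.coalg Y.coalg := f.left.hom

/-- The underlying morphism in the base category. -/
noncomputable def objHom (f : X ⟶ Y) : X.coalg.obj ⟶ Y.coalg.obj := (coalgHom f).hom

theorem objHom_comp (f : X ⟶ Y) (g : Y ⟶ Z) : objHom (f ≫ g) = objHom f ≫ objHom g := rfl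

theorem objHom_comm (f : X ⟶ Y) (α : D.Op) :
    X.coalg.coop α ≫ Limits.Sigma.map (fun _ => objHom f) = objHom f ≫ Y.coalg.coop α :=
  (coalgHom f).comm α

theorem objHom_toBase (f : X ⟶ Y) : objHom f ≫ Y.toBase = X.toBase :=
  congrArg Pseudocoalg.Hom.base (CostructuredArrow.w f)

theorem hom_ext {f g : X ⟶ Y} (h : objHom f = objHom g) : f = g := by
  apply CostructuredArrow.hom_ext
  apply ObjectProperty.hom_ext
  exact OmegaCoalg.Hom.ext h

theorem exists_hom (f : X.coalg.obj ⟶ Y.coalg.obj)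
    (hf : ∀ α : D.Op, X.coalg.coop α ≫ Limits.Sigma.map (fun _ => f) = f ≫ Y.coalg.coop α)
    (hb : f ≫ Y.toBase = X.toBase) : ∃ g : X ⟶ Y, objHom g = f := by
  let F : X.left ⟶ Y.left := ObjectProperty.homMk (OmegaCoalg.Hom.mk f hf)
  refine ⟨CostructuredArrow.homMk F (Pseudocoalg.Hom.ext hb (funext fun α => ?_)), rfl⟩
  refine (congrArg (fun k : (∐ fun _ : D.ar α => Y.coalg.obj) ⟶ S.obj α =>
    Limits.Sigma.map (fun _ => f) ≫ k) (Y.hom_obj_eq_desc α)).trans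
      (Eq.trans ?_ (X.hom_obj_eq_desc α).symm)
  apply Limits.Sigma.hom_ext
  intro i
  simp [← hb]

/-- Small families of coalgebras over a pseudocoalgebra have upper bounds, carried by the
coproducts of the underlying objects. -/
theorem exists_cocone {ι : Type u} (X : ι → CoalgOver D S) :
    ∃ W : CoalgOver D S, ∀ k, Nonempty (X k ⟶ W) := by
  let A : ι → 𝒜 := fun k => (X k).coalg.obj
  let R : OmegaCoalg D.toSignature 𝒜 :=
    { obj := ∐ A
      coop := fun α => Limits.Sigma.desc fun k =>
        (X k).coalg.coop α ≫ Limits.Sigma.map fun _ => Sigma.ι A k }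
  let inj : ∀ k, OmegaCoalg.Hom (X k).coalg R := fun k =>
    { hom := Sigma.ι A k
      comm := fun α => by simp [R] }
  -- The coprojections are jointly epimorphic, so the identities pass to the coproduct.
  have hR : ∀ e : D.Eqn, R.Cosatisfies (D.lhs e) (D.rhs e) := fun e =>
    .of_jointly_epi inj (fun B g h hgh => Limits.Sigma.hom_ext _ _ hgh)
      fun k => (X k).left.property e
  let b : R.obj ⟶ S.base := Limits.Sigma.desc fun k => (X k).toBase
  have hι : ∀ k, Sigma.ι A k ≫ b = (X k).toBase := fun k => colimit.ι_desc _ _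
  refine ⟨ofBase R hR b fun α => ?_, fun k => ?_⟩
  · apply Limits.Sigma.hom_ext
    intro k
    rw [← Category.assoc, ← Category.assoc, hι, ← coop_desc, ← (inj k).comm α, Category.assoc]
    congr 1
    apply Limits.Sigma.hom_ext
    intro i
    rw [← Category.assoc, Limits.Sigma.ι_map, Category.assoc, colimit.ι_desc, colimit.ι_desc]
    exact (Category.assoc _ _ _).symm.trans (congrArg (· ≫ S.coproj α i) (hι k))
  · obtain ⟨g, -⟩ := exists_hom (X := X k) (Y := ofBase R hR b _) (inj k).hom (inj k).comm (hι k)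
    exact ⟨g⟩

end CoalgOver

end Over

/-! ### The largest quotient of a coalgebra over a pseudocoalgebra -/

section MaximalQuotient

variable {C D : Variety.{u}} {S : Pseudocoalg D.toSignature (Alg C)}

namespace CoalgOver

/-- Quotients of a coalgebra over a pseudocoalgebra by a relation that the structure respects. -/
theorem exists_quotient (X : CoalgOver D S)
    (P : X.coalg.obj.carrier → X.coalg.obj.carrier → Prop)
    (hbase : ∀ x y, P x y → X.toBase.toFun x = X.toBase.toFun y)
    (hcoop : ∀ (B : Alg C) (f : X.coalg.obj ⟶ B), (∀ x y, P x y → f.toFun x = f.toFun y) →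
      ∀ (α : D.Op) (x y), P x y →
        Alg.Hom.toFun (X.coalg.coop α ≫ Limits.Sigma.map fun _ => f) x =
          Alg.Hom.toFun (X.coalg.coop α ≫ Limits.Sigma.map fun _ => f) y) :
    ∃ (Q : CoalgOver D S) (q : X ⟶ Q), Function.Surjective (objHom q).toFun ∧
      ∀ x y, P x y → (objHom q).toFun x = (objHom q).toFun y := by
  let A := X.coalg.obj
  have hq := A.quotMk_surjective P
  -- The hypothesis on co-operations, taken at the quotient map itself, is what lets them descend.
  choose k hk using fun α => Alg.exists_quotDesc P
    (X.coalg.coop α ≫ Limits.Sigma.map fun _ => A.quotMk P)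
    (hcoop _ _ (fun _ _ h => Alg.quotMk_eq h) α)
  obtain ⟨b, hb⟩ := Alg.exists_quotDesc P X.toBase hbase
  let R : OmegaCoalg D.toSignature (Alg C) := ⟨A.quot P, k⟩
  let q : OmegaCoalg.Hom X.coalg R := ⟨A.quotMk P, fun α => (hk α).symm⟩
  have hR : ∀ e : D.Eqn, R.Cosatisfies (D.lhs e) (D.rhs e) := fun e =>
    .of_jointly_epi (fun _ : Unit => q) (fun B g h hgh => Alg.cancel_surjective hq (hgh ()))
      fun _ => X.left.property e
  have hS : ∀ α : D.Op, R.coop α ≫ Limits.Sigma.desc (fun i => b ≫ S.coproj α i) =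
      b ≫ S.coop α := by
    intro α
    apply Alg.cancel_surjective hq
    rw [← Category.assoc, ← Category.assoc, hb, ← coop_desc]
    refine (congrArg (· ≫ Limits.Sigma.desc fun i => b ≫ S.coproj α i) (hk α)).trans ?_
    rw [Category.assoc]
    congr 1
    apply Limits.Sigma.hom_ext
    intro i
    rw [← Category.assoc, Limits.Sigma.ι_map, Category.assoc, colimit.ι_desc, colimit.ι_desc,
      ← hb]
    exact (Category.assoc _ _ _).symm
  obtain ⟨g, hg⟩ := exists_hom (X := X) (Y := ofBase R hR b hS) q.hom q.comm hb
  refine ⟨ofBase R hR b hS, g, ?_, ?_⟩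
  · rw [hg]
    exact hq
  · rw [hg]
    exact fun _ _ h => Alg.quotMk_eq h

/-- Every coalgebra over a pseudocoalgebra maps to one that receives at most one morphism from
each coalgebra over the pseudocoalgebra. -/
theorem exists_subterminal (X : CoalgOver D S) :
    ∃ M : CoalgOver D S, Nonempty (X ⟶ M) ∧ ∀ (R : CoalgOver D S) (f g : R ⟶ M), f = g := by
  -- The relation is the union of the kernels of all surjective morphisms out of X over S. Any f
  -- that kills it factors through each of these quotients, hence respects their co-operations.
  obtain ⟨M, q, hq, hP⟩ := X.exists_quotient
    (fun x y => ∃ (Q : CoalgOver D S) (q : X ⟶ Q), Function.Surjective (objHom q).toFun ∧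
      (objHom q).toFun x = (objHom q).toFun y)
    (by
      rintro x y ⟨Q, q, -, h⟩
      rw [← objHom_toBase q, Alg.comp_toFun, h, Alg.comp_toFun])
    (by
      rintro B f hf α x y ⟨Q, q, hq, h⟩
      obtain ⟨u, rfl⟩ := Alg.exists_factor_of_surjective (objHom q) hq f
        fun x y hxy => hf x y ⟨Q, q, hq, hxy⟩
      have hu : (Limits.Sigma.map fun _ : D.ar α => objHom q ≫ u) =
          (Limits.Sigma.map fun _ => objHom q) ≫ Limits.Sigma.map fun _ => u := by
        apply Limits.Sigma.hom_ext
        intro i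
        simp
      rw [hu, ← Category.assoc, objHom_comm]
      simp only [Alg.comp_toFun, h])
  refine ⟨M, ⟨q⟩, fun R f g => hom_ext (Alg.hom_ext fun r => ?_)⟩
  -- Q coequalizes f and g. As X → M → Q is again a surjective quotient of X, its kernel is already
  -- trivial in M.
  obtain ⟨Q, p, hp, hpP⟩ := M.exists_quotient
    (fun x y => ∃ r, x = (objHom f).toFun r ∧ y = (objHom g).toFun r)
    (by
      rintro _ _ ⟨r, rfl, rfl⟩
      rw [← Alg.comp_toFun, ← Alg.comp_toFun, objHom_toBase, objHom_toBase])
    (by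
      rintro B k hk α _ _ ⟨r, rfl, rfl⟩
      have hfg : objHom f ≫ k = objHom g ≫ k := Alg.hom_ext fun r => hk _ _ ⟨r, rfl, rfl⟩
      have hcomp : ∀ f : R ⟶ M, objHom f ≫ M.coalg.coop α ≫ (Limits.Sigma.map fun _ => k) =
          R.coalg.coop α ≫ Limits.Sigma.map fun _ => objHom f ≫ k := by
        intro f
        rw [← Category.assoc, ← objHom_comm, Category.assoc]
        congr 1
        apply Limits.Sigma.hom_ext
        intro i
        simp
      rw [← Alg.comp_toFun, ← Alg.comp_toFun, hcomp, hcomp, hfg])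
  obtain ⟨a, ha⟩ := hq ((objHom f).toFun r)
  obtain ⟨b, hb⟩ := hq ((objHom g).toFun r)
  rw [← ha, ← hb]
  refine hP a b ⟨Q, q ≫ p, hp.comp hq, ?_⟩
  rw [objHom_comp, Alg.comp_toFun, Alg.comp_toFun, ha, hb]
  exact hpP _ _ ⟨r, rfl, rfl⟩

end CoalgOver

end MaximalQuotient

end UnivAlg

namespace UnivAlg

/-! ### Codes of small coalgebras -/

section Codes

variable {C D : Variety.{u}} {S : Pseudocoalg D.toSignature (Alg C)}

/-- The data of a coalgebra over a pseudocoalgebra on a subset of `M`, with the values of the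
co-operations given by terms. -/
def Code (S : Pseudocoalg D.toSignature (Alg C)) (M : Type u) : Type u :=
  Σ s : Set M, (∀ α : C.Op, (C.ar α → s) → s) × (s → S.base.carrier) ×
    (∀ α : D.Op, s → Term C.toSignature (Σ _ : D.ar α, s))

/-- The bijection `e` identifies the data of a code with those of a coalgebra. -/
structure Code.Realizes {M : Type u} (c : Code S M) (X : CoalgOver D S)
    (e : c.1 ≃ X.coalg.obj.carrier) : Prop where
  op : ∀ (α : C.Op) (x : C.ar α → c.1),
    e (c.2.1 α x) = X.coalg.obj.op α fun i => e (x i)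
  base : ∀ a, X.toBase.toFun (e a) = c.2.2.1 a
  coop : ∀ (α : D.Op) (a),
    termVal (D.ar α) X.coalg.obj ((c.2.2.2 α a).map (sigmaMap id e)) =
      (X.coalg.coop α).toFun (e a)

/-- The algebra is transported to a subset of M, and each value of a co-operation is represented by
a chosen term. A coalgebra may thus have many codes, which does no harm. -/
theorem Code.exists_realizes {M : Type u} (X : CoalgOver D S)
    (hX : #X.coalg.obj.carrier ≤ #M) : ∃ (c : Code S M) (e : _), c.Realizes X e := by
  obtain ⟨f⟩ := hX
  let e : Set.range f ≃ X.coalg.obj.carrier := (Equiv.ofInjective f f.injective).symm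
  choose t ht using fun (α : D.Op) (a : Set.range f) =>
    termVal_surjective ((X.coalg.coop α).toFun (e a))
  refine ⟨⟨Set.range f, fun α x => e.symm (X.coalg.obj.op α fun i => e (x i)),
    fun a => X.toBase.toFun (e a), fun α a => (t α a).map (sigmaMap id e.symm)⟩, e,
    fun α x => e.apply_symm_apply _, fun a => rfl, fun α a => ?_⟩
  rw [← ht, Term.map_map]
  congr 1
  refine Eq.trans ?_ (Term.map_id _)
  congr 1
  funext p
  exact Sigma.ext rfl (heq_of_eq (e.apply_symm_apply _))

/-- Coalgebras with the same code are isomorphic. -/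
theorem Code.Realizes.exists_hom {M : Type u} {c : Code S M} {X Y : CoalgOver D S}
    {e : c.1 ≃ X.coalg.obj.carrier} {e' : c.1 ≃ Y.coalg.obj.carrier}
    (h : c.Realizes X e) (h' : c.Realizes Y e') :
    ∃ f : X ⟶ Y, ∀ a, (CoalgOver.objHom f).toFun (e a) = e' a := by
  let f : X.coalg.obj ⟶ Y.coalg.obj := Alg.Hom.mk (fun x => e' (e.symm x)) fun α x => by
    rw [← h'.op, EmbeddingLike.apply_eq_iff_eq, Equiv.symm_apply_eq, h.op]
    simp
  have hf : ∀ a, f.toFun (e a) = e' a := fun a => by simp [f]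
  obtain ⟨g, hg⟩ := CoalgOver.exists_hom f
    (fun α => Alg.hom_ext fun x => by
      obtain ⟨a, rfl⟩ := e.surjective x
      rw [Alg.comp_toFun, Alg.comp_toFun, hf, ← h.coop, ← termVal_map_id, Term.map_map,
        ← h'.coop]
      congr 2
      funext p
      exact Sigma.ext rfl (heq_of_eq (hf _)))
    (Alg.hom_ext fun x => by
      obtain ⟨a, rfl⟩ := e.surjective x
      rw [Alg.comp_toFun, hf, h.base, h'.base])
  exact ⟨g, fun a => by rw [hg, hf]⟩

theorem mk_pi_le_of_le {ι : Type u} {F : ι → Type u} {k m : Cardinal.{u}} (hk : k ≠ 0)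
    (hkm : k ^ m = k) (hι : #ι ≤ m) (hF : ∀ i, #(F i) ≤ k) : #(∀ i, F i) ≤ k :=
  calc #(∀ i, F i) = Cardinal.prod fun i => #(F i) := mk_pi F
    _ ≤ Cardinal.prod fun _ : ι => k := prod_le_prod _ _ hF
    _ = k ^ #ι := prod_const' _ _
    _ ≤ k ^ m := power_le_power_left hk hι
    _ = k := hkm

/-- All data are families of at most m entries from sets of size at most `k ^ m`, which is stable
under the exponent m. -/
theorem Code.mk_le {m k : Cardinal.{u}} (hlm : C.lam ≤ m) (hC : #C.Op ≤ m) (hD : #D.Op ≤ m)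
    (hpow : ∀ i : Cardinal.{u}, i ≠ 0 → i < C.lam → m ^ i = m)
    (hS : #S.base.carrier ≤ k) (hk : D.lam ≤ k) : #(Code S m.out) ≤ k ^ m := by
  have hm : ℵ₀ ≤ m := C.lam_isRegular.aleph0_le.trans hlm
  have hm0 : m ≠ 0 := (aleph0_pos.trans_le hm).ne'
  have hkN : k ≤ k ^ m := self_le_power k (one_le_aleph0.trans hm)
  have hk2 : 2 ≤ k := (ofNat_le_aleph0.trans D.lam_isRegular.aleph0_le).trans hk
  have h2N : 2 ^ m ≤ k ^ m := power_le_power_right hk2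
  have hmN : m ≤ k ^ m := (cantor m).le.trans h2N
  have hN : ℵ₀ ≤ k ^ m := hm.trans hmN
  have hN0 : k ^ m ≠ 0 := (aleph0_pos.trans_le hN).ne'
  have hNm : (k ^ m) ^ m = k ^ m := by rw [← power_mul, mul_eq_self hm]
  unfold Code
  rw [mk_sigma]
  refine sum_le_of_le _ hN ?_ fun s => ?_
  · rw [mk_set, mk_out]
    exact h2N
  · have hs : #s ≤ m := (mk_set_le s).trans_eq (mk_out m)
    rw [mk_prod, mk_prod]
    simp only [lift_id]
    refine mul_le_of_le hN ?_ (mul_le_of_le hN ?_ ?_)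
    · refine mk_pi_le_of_le hN0 hNm hC fun α => mk_pi_le_of_le hN0 hNm ?_ fun _ => hs.trans hmN
      rw [← power_def]
      exact (power_le_power_right hs).trans
        (power_le_self_of_power_eq (one_le_aleph0.trans hm) hpow (C.mk_ar_lt α))
    · exact mk_pi_le_of_le hN0 hNm hs fun _ => hS.trans hkN
    · refine mk_pi_le_of_le hN0 hNm hD fun α => mk_pi_le_of_le hN0 hNm hs fun _ => ?_
      refine Term.mk_le hN ?_ (hC.trans hmN) C.lam_isRegular.pos C.mk_ar_lt
        (power_eq_of_le_exponent hlm hm)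
      rw [mk_sigma]
      -- The arities of D enter only as numbers of copies, that is, of indeterminates; λ_D ≤ k keeps
      -- them within the bound.
      exact sum_le_of_le _ hN ((D.mk_ar_lt α).le.trans (hk.trans hkN)) fun _ => hs.trans hmN

/-! ### The cardinality of subterminal coalgebras -/

namespace CoalgOver

/-- Every element of a coalgebra over a pseudocoalgebra lies in the image of a small one. -/
theorem exists_small_hom {m : Cardinal.{u}} (hlm : C.lam ≤ m) (hC : #C.Op ≤ m) (hD : #D.Op ≤ m)
    (hpow : ∀ i : Cardinal.{u}, i ≠ 0 → i < C.lam → m ^ i = m)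
    (X : CoalgOver D S) (x : X.coalg.obj.carrier) :
    ∃ (G : CoalgOver D S) (f : G ⟶ X), #G.coalg.obj.carrier ≤ m ∧
      x ∈ Set.range (objHom f).toFun := by
  obtain ⟨G, f, hf, hG, hx⟩ := X.coalg.exists_small_sub hlm hC hD hpow x
  have hb : ∀ α : D.Op, G.coop α ≫
      Limits.Sigma.desc (fun i => (f.hom ≫ X.toBase) ≫ S.coproj α i) =
        (f.hom ≫ X.toBase) ≫ S.coop α := by
    intro α
    rw [Category.assoc, ← coop_desc, ← Category.assoc f.hom, ← f.comm, Category.assoc]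
    congr 1
    apply Limits.Sigma.hom_ext
    intro i
    simp
  obtain ⟨g, hg⟩ := exists_hom
    -- Purity at the indeterminates of each identity makes the map of copowers a monomorphism, so G
    -- inherits the identities of D.
    (X := ofBase G (fun e => .of_mono f (Alg.mono_of_injective _ (hf _)) (X.left.property e))
      (f.hom ≫ X.toBase) hb) (Y := X) f.hom f.comm rfl
  exact ⟨_, g, hG, by rwa [hg]⟩

/-- A bound for the coalgebras over a pseudocoalgebra that receive at most one morphism from
each coalgebra over it. -/
theorem mk_le_of_subterminal {m k : Cardinal.{u}} (hlm : C.lam ≤ m) (hC : #C.Op ≤ m)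
    (hD : #D.Op ≤ m) (hpow : ∀ i : Cardinal.{u}, i ≠ 0 → i < C.lam → m ^ i = m)
    (hS : #S.base.carrier ≤ k) (hk : D.lam ≤ k)
    (V : CoalgOver D S) (hV : ∀ (R : CoalgOver D S) (f g : R ⟶ V), f = g) :
    #V.coalg.obj.carrier ≤ k ^ m := by
  have hm : ℵ₀ ≤ m := C.lam_isRegular.aleph0_le.trans hlm
  have hk2 : 2 ≤ k := (ofNat_le_aleph0.trans D.lam_isRegular.aleph0_le).trans hk
  have hmN : m ≤ k ^ m := (cantor m).le.trans (power_le_power_right hk2)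
  choose G f hG y hy using V.exists_small_hom hlm hC hD hpow
  choose c e he using fun x =>
    Code.exists_realizes (M := m.out) (G x) ((hG x).trans_eq (mk_out m).symm)
  let code : V.coalg.obj.carrier → Σ c : Code S m.out, c.1 := fun x => ⟨c x, (e x).symm (y x)⟩
  have hcode : Function.Injective code := by
    -- The codes are generalized to variables so that equality of pairs can be eliminated by
    -- substitution.
    have key : ∀ (x x' : V.coalg.obj.carrier) (c c' : Code S m.out)
        (e : c.1 ≃ (G x).coalg.obj.carrier) (e' : c'.1 ≃ (G x').coalg.obj.carrier),
        c.Realizes _ e → c'.Realizes _ e' →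
        (⟨c, e.symm (y x)⟩ : Σ c : Code S m.out, c.1) = ⟨c', e'.symm (y x')⟩ → x = x' := by
      intro x x' c c' e e' he he' h
      obtain ⟨rfl, h⟩ := Sigma.mk.inj h
      obtain ⟨g, hg⟩ := he.exists_hom he'
      have hgy : (objHom g).toFun (y x) = y x' := by
        have := hg (e.symm (y x))
        rwa [eq_of_heq h, e'.apply_symm_apply, ← eq_of_heq h, e.apply_symm_apply] at this
      -- Both `g ≫ f x'` and `f x` are morphisms from G x to V, so they coincide.
      rw [← hy x, ← hy x', ← hgy, ← Alg.comp_toFun, ← objHom_comp, hV _ (g ≫ f x') (f x)]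
    exact fun x x' h => key x x' _ _ _ _ (he x) (he x') h
  refine (mk_le_of_injective hcode).trans ?_
  rw [mk_sigma]
  exact sum_le_of_le _ (hm.trans hmN) (Code.mk_le hlm hC hD hpow hS hk) fun c =>
    ((mk_set_le c.1).trans_eq (mk_out m)).trans hmN

end CoalgOver

end Codes

end UnivAlg

/-! ### The final object and its size -/

/-- For every pseudocoalgebra `S` the category of coalgebras over `S` has a final object, and the
cardinality of the underlying set of the final object is bounded as displayed. -/
theorem theoremT (C D : Variety.{u}) (S : Pseudocoalg D.toSignature (Alg C)) :
    HasTerminal (CoalgOver D S) ∧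
      ∀ T : CoalgOver D S, IsTerminal T →
        #T.left.obj.obj.carrier ≤
          (max #S.base.carrier D.lam) ^ expLess (max (max #C.Op #D.Op) 2) C.lam := by
  obtain ⟨⟨hκm, hpow⟩, -⟩ :=
    isLeast_expLess (max (max #C.Op #D.Op) 2) C.lam_isRegular.aleph0_le
  generalize expLess (max (max #C.Op #D.Op) 2) C.lam = m at hκm hpow
  have hC : #C.Op ≤ m := (le_max_left _ _).trans ((le_max_left _ _).trans hκm)
  have hD : #D.Op ≤ m := (le_max_right _ _).trans ((le_max_left _ _).trans hκm)
  -- The entry 2 in the maximum is needed here, to exclude the degenerate values m = 0 and m = 1.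
  have hlm : C.lam ≤ m := le_of_power_eq ((le_max_right _ _).trans hκm) hpow
  have hbound := CoalgOver.mk_le_of_subterminal (S := S) hlm hC hD hpow
    (le_max_left #S.base.carrier D.lam) (le_max_right _ _)
  refine ⟨?_, fun T hT => hbound T fun _ _ _ => hT.hom_ext _ _⟩
  let M : Type u := ((max #S.base.carrier D.lam) ^ m).out
  -- Coalgebras over S form a large class, but the realizable codes on a set of size `k ^ m` form a
  -- small index set that covers every subterminal one.
  let I : Type u := {c : Code S M // ∃ (X : CoalgOver D S) (e : _), c.Realizes X e}
  choose X e he using fun c : I => c.2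
  obtain ⟨W, hW⟩ := CoalgOver.exists_cocone X
  obtain ⟨T, ⟨q⟩, hT⟩ := W.exists_subterminal
  have hex : ∀ R : CoalgOver D S, Nonempty (R ⟶ T) := by
    intro R
    obtain ⟨V, ⟨p⟩, hV⟩ := R.exists_subterminal
    obtain ⟨c, e', hc⟩ := Code.exists_realizes (M := M) V ((hbound V hV).trans_eq (mk_out _).symm)
    obtain ⟨g, -⟩ := hc.exists_hom (he ⟨c, V, e', hc⟩)
    obtain ⟨i⟩ := hW ⟨c, V, e', hc⟩
    exact ⟨p ≫ g ≫ i ≫ q⟩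
  exact (IsTerminal.ofUniqueHom (fun R => (hex R).some) fun R f => hT R _ _).hasTerminal
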